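/- All designs are finite. A $2$-$(v,k,\lambda)$ design consists of $v$ points and a finite family of blocks (repeated blocks are allowed), each block having $k$ points, such that any two distinct points lie together in exactly $\lambda$ blocks; if each point lies in exactly $r$ blocks, its order is $r-\lambda$. It is quasi-symmetric if the numbers of common points of two distinct blocks take exactly two values $\lambda_1<\lambda_2$; its block graph then has the blocks as vertices, two distinct blocks being adjacent iff they have exactly $\lambda_2$ common points. For nonzero rationals write $x\equiv y$ if $x/y$ is the square of a rational number. For a prime $p$ and nonzero rationals $a,b$, the Hilbert symbol $(a,b)_p$ is $+1$ if $ax^2+by^2=z^2$ has a solution $(x,y,z)\ne(0,0,0)$ in $\mathbb{Q}_p$, and $-1$ otherwise. For a nonsingular symmetric rational matrix $A$ the Hasse invariant is $\epsilon_p(A)=\prod_{i<j}(d_i,d_j)_p$, where $\mathrm{diag}(d_1,\dots,d_n)=X^{T}AX$ for some nonsingular rational matrix $X$ (this does not depend on the choice of $X$). Let $G$ be a connected strongly regular graph all of whose eigenvalues are integers, with exactly three distinct eigenvalues $a>\rho>\sigma$, where $a$ is the degree of $G$, of multiplicities $1,f,g$ respectively. Let $E$ be the (rational) matrix of the orthogonal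 projection onto the $\sigma$-eigenspace of the adjacency matrix of $G$, and put $\delta(G)=\det(E_0)$ (regarded modulo squares of nonzero rationals) and $\epsilon_p(G)=\epsilon_p(E_0)$ for a nonsingular $g\times g$ principal submatrix $E_0$ of $E$. **Theorem 4.2.** Let $G$ be as above and let $\nu$ be a positive integer. Suppose that there is a quasi-symmetric $2$-design of order $\nu$ whose block graph is isomorphic to $G$. Then a nonsingular $g\times g$ principal submatrix $E_0$ of $E$ exists, and for every choice of $E_0$: (a) $\nu^{f}\equiv (f+1)(f+g+1)\,\delta(G)$; (b) for every prime $p$, $$(-1,\nu)_p^{\binom f2}\,(\nu,f+1)_p=(f+g+1,\,-f-1)_p\,\bigl(-(f+1)(f+g+1),\,\delta(G)\bigr)_p\,\epsilon_p(G).$$ -/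

import Mathlib

open Matrix

/-! ### Strongly regular graphs and their spectral parameters -/

/-- `G` is strongly regular: it is regular of some degree `a`, and there are constants `c`, `d` such
that two distinct vertices have exactly `c` or `d` common neighbours according as they are adjacent
or not. -/
def IsStronglyRegular {V : Type*} [Fintype V] [DecidableEq V] (G : SimpleGraph V)
    [DecidableRel G.Adj] : Prop :=
  ∃ n a c d : ℕ, G.IsSRGWith n a c d

/-- The multiplicity of the real number `t` as an eigenvalue of (the adjacency matrix of) `G`. -/
noncomputable def eigMult {V : Type*} [Fintype V] [DecidableEq V] (G : SimpleGraph V)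
    [DecidableRel G.Adj] (t : ℝ) : ℕ :=
  Module.finrank ℝ (Module.End.eigenspace (Matrix.toLin' (G.adjMatrix ℝ)) t)

/-- `ρ, σ, f, g` are the spectral parameters of `G`: the eigenvalues of `G` are exactly
`a > ρ > σ`, where `a` is the degree of `G`, and their multiplicities are `1, f, g`.
As `ρ` and `σ` are integers, all the eigenvalues of `G` are integers. -/
structure HasSpectralParameters {V : Type*} [Fintype V] [DecidableEq V] (G : SimpleGraph V)
    [DecidableRel G.Adj] (ρ σ : ℤ) (f g : ℕ) : Prop where
  eigenvalues : ∃ a : ℕ, G.IsRegularOfDegree a ∧ σ < ρ ∧ ρ < (a : ℤ) ∧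
    (∀ t : ℝ, Module.End.HasEigenvalue (Matrix.toLin' (G.adjMatrix ℝ)) t ↔
      t = a ∨ t = ρ ∨ t = σ) ∧
    eigMult G a = 1
  mult_rho : eigMult G ρ = f
  mult_sigma : eigMult G σ = g

/-! ### Quasi-symmetric 2-designs

A design on the point set `P` is a family `B : β → Finset P` of blocks (repeated blocks are
allowed, as distinct indices count as distinct blocks). -/

/-- `B` is a `2-(v, k, lam)` design. -/
structure IsTwoDesign {P β : Type*} [Fintype P] [DecidableEq P] [Fintype β]
    (B : β → Finset P) (v k lam : ℕ) : Prop where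
  card_points : Fintype.card P = v
  card_block : ∀ i, (B i).card = k
  balance : ∀ x y, x ≠ y → (Finset.univ.filter fun i => x ∈ B i ∧ y ∈ B i).card = lam

/-- Each point lies on exactly `r` blocks. -/
def HasReplication {P β : Type*} [DecidableEq P] [Fintype β] (B : β → Finset P) (r : ℕ) : Prop :=
  ∀ x, (Finset.univ.filter fun i => x ∈ B i).card = r

/-- The set of intersection numbers of `B`. -/
def intersectionNumbers {P β : Type*} [DecidableEq P] (B : β → Finset P) : Set ℕ :=
  {m | ∃ i j, i ≠ j ∧ (B i ∩ B j).card = m}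

/-- The graph on the blocks, two distinct blocks being adjacent iff they meet in `l₂` points. -/
def blockGraph {P β : Type*} [DecidableEq P] (B : β → Finset P) (l₂ : ℕ) : SimpleGraph β where
  Adj i j := i ≠ j ∧ (B i ∩ B j).card = l₂
  symm := ⟨fun i j h => ⟨h.1.symm, by rw [Finset.inter_comm]; exact h.2⟩⟩
  loopless := ⟨fun _ h => h.1 rfl⟩

/-- `B` is a quasi-symmetric 2-design of order `ν = r - lam`, that is, a 2-design with exactly two
intersection numbers `l₁ < l₂`, and its block graph is (isomorphic to) `G`. -/
def IsQuasiSymmetricDesign {P β V : Type*} [Fintype P] [DecidableEq P] [Fintype β]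
    (B : β → Finset P) (ν : ℕ) (G : SimpleGraph V) : Prop :=
  ∃ v k lam r l₁ l₂ : ℕ, IsTwoDesign B v k lam ∧ HasReplication B r ∧ r = lam + ν ∧
    l₁ < l₂ ∧ intersectionNumbers B = {l₁, l₂} ∧ Nonempty (blockGraph B l₂ ≃g G)

/-! ### Hilbert symbols and Hasse invariants -/

/-- `x ≡ y` modulo the squares of nonzero rationals. -/
def SqEquiv (x y : ℚ) : Prop := ∃ q : ℚ, q ≠ 0 ∧ x = y * q ^ 2

open Classical in
/-- The `p`-adic Hilbert symbol `(a, b)_p` (meant for nonzero `a`, `b`). -/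
noncomputable def hilbertSym (p : ℕ) [Fact p.Prime] (a b : ℚ) : ℤˣ :=
  if ∃ x y z : ℚ_[p], ¬(x = 0 ∧ y = 0 ∧ z = 0) ∧
      (a : ℚ_[p]) * x ^ 2 + (b : ℚ_[p]) * y ^ 2 = z ^ 2
  then 1 else -1

/-- Rational equivalence of matrices. -/
def RatEquiv {n : ℕ} (A B : Matrix (Fin n) (Fin n) ℚ) : Prop :=
  ∃ X : Matrix (Fin n) (Fin n) ℚ, X.det ≠ 0 ∧ B = Xᵀ * A * X

/-- The `p`-adic invariant `∏_{i < j} (d i, d j)_p` of the diagonal matrix with entries `d`. -/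
noncomputable def diagHasse (p : ℕ) [Fact p.Prime] {n : ℕ} (d : Fin n → ℚ) : ℤˣ :=
  ∏ i : Fin n, ∏ j ∈ Finset.Ioi i, hilbertSym p (d i) (d j)

/-- Nonsingular symmetric rational matrices are rationally equivalent to nonsingular diagonal
matrices. -/
theorem exists_diagonal {n : ℕ} (A : Matrix (Fin n) (Fin n) ℚ) (hA : A.IsSymm)
    (hdet : A.det ≠ 0) :
    ∃ d : Fin n → ℚ, (∀ i, d i ≠ 0) ∧ RatEquiv A (diagonal d) := by
  have : Invertible (2 : ℚ) := invertibleOfNonzero two_ne_zero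
  have hB : LinearMap.IsSymm (Matrix.toBilin' A) := by
    refine ⟨fun x y => ?_⟩
    simp only [RingHom.id_apply, Matrix.toBilin'_apply']
    rw [dotProduct_mulVec, ← mulVec_transpose, hA.eq, dotProduct_comm]
  obtain ⟨v₀, hv₀⟩ := LinearMap.BilinForm.exists_orthogonal_basis hB
  have hn : Module.finrank ℚ (Fin n → ℚ) = n := by simp
  let v : Module.Basis (Fin n) ℚ (Fin n → ℚ) := v₀.reindex (finCongr hn)
  have hv : ∀ i j, i ≠ j → Matrix.toBilin' A (v i) (v j) = 0 := by
    intro i j hij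
    have := hv₀ (i := (finCongr hn).symm i) (j := (finCongr hn).symm j) (by simpa using hij)
    simpa [v] using this
  let X : Matrix (Fin n) (Fin n) ℚ := Matrix.of fun i j => v j i
  have hXdet : X.det ≠ 0 := by
    have h1 : LinearIndependent ℚ X.col := v.linearIndependent
    have h2 := Matrix.linearIndependent_cols_iff_isUnit.1 h1
    exact ((Matrix.isUnit_iff_isUnit_det _).1 h2).ne_zero
  have hentry : ∀ i j, (Xᵀ * A * X) i j = Matrix.toBilin' A (v i) (v j) := by
    intro i j
    rw [Matrix.toBilin'_apply', dotProduct_mulVec, Matrix.mul_apply]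
    simp only [dotProduct, Matrix.mul_apply, vecMul, transpose_apply, X, Matrix.of_apply]
  have hdiag : diagonal (fun i => Matrix.toBilin' A (v i) (v i)) = Xᵀ * A * X := by
    ext i j
    rw [hentry]
    by_cases hij : i = j
    · subst hij; simp
    · rw [diagonal_apply_ne _ hij, hv i j hij]
  refine ⟨fun i => Matrix.toBilin' A (v i) (v i), fun i hi => ?_, X, hXdet, hdiag⟩
  have h3 := congrArg Matrix.det hdiag
  rw [det_diagonal, det_mul, det_mul, det_transpose] at h3
  rw [Finset.prod_eq_zero (Finset.mem_univ i) hi] at h3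
  exact mul_ne_zero (mul_ne_zero hXdet hdet) hXdet h3.symm

open Classical in
/-- The `p`-adic Hasse invariant of a nonsingular symmetric rational matrix `A`: the invariant of
any nonsingular diagonal matrix rationally equivalent to `A` (it does not depend on the choice;
the value is `1` if there is none, which does not happen for nonsingular symmetric `A`). -/
noncomputable def hasseInv (p : ℕ) [Fact p.Prime] {n : ℕ} (A : Matrix (Fin n) (Fin n) ℚ) : ℤˣ :=
  if h : ∃ d : Fin n → ℚ, (∀ i, d i ≠ 0) ∧ RatEquiv A (diagonal d) then diagHasse p h.choose else 1

/-! ### The idempotent onto an eigenspace and its principal submatrices -/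

/-- Over `ℚ`, every subspace of `ℚ^V` is complementary to its orthogonal for the dot product. -/
theorem isCompl_dotProduct_orthogonal {V : Type*} [Fintype V] (W : Submodule ℚ (V → ℚ)) :
    IsCompl W (LinearMap.BilinForm.orthogonal (dotProductBilin ℚ ℚ) W) := by
  have hR : LinearMap.IsRefl (dotProductBilin ℚ ℚ : LinearMap.BilinForm ℚ (V → ℚ)) := by
    intro x y h
    simpa [dotProduct_comm] using h
  rw [LinearMap.BilinForm.isCompl_orthogonal_iff_disjoint hR, Submodule.disjoint_def]
  intro x hx hx'
  have h : x ⬝ᵥ x = 0 := hx' x hx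
  exact dotProduct_self_eq_zero.1 h

/-- The `σ`-eigenspace of `G` over `ℚ`. -/
noncomputable def eigSpace {V : Type*} [Fintype V] [DecidableEq V] (G : SimpleGraph V)
    [DecidableRel G.Adj] (σ : ℤ) : Submodule ℚ (V → ℚ) :=
  Module.End.eigenspace (Matrix.toLin' (G.adjMatrix ℚ)) (σ : ℚ)

/-- The matrix of the orthogonal projection of `ℚ^V` onto the `σ`-eigenspace of `G`. -/
noncomputable def eigProj {V : Type*} [Fintype V] [DecidableEq V] (G : SimpleGraph V)
    [DecidableRel G.Adj] (σ : ℤ) : Matrix V V ℚ :=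
  LinearMap.toMatrix' (Submodule.projection _ _ (isCompl_dotProduct_orthogonal (eigSpace G σ)))

/-- The `g × g` principal submatrix of the idempotent on the vertices `e 0, …, e (g - 1)`. -/
noncomputable def principalSub {V : Type*} [Fintype V] [DecidableEq V] (G : SimpleGraph V)
    [DecidableRel G.Adj] (σ : ℤ) {g : ℕ} (e : Fin g ↪ V) : Matrix (Fin g) (Fin g) ℚ :=
  (eigProj G σ).submatrix e e

/-! ### Norms from quadratic extensions -/

/-- `b` is of the form `x² - a y²`, that is, a norm from `K(√a)` when `a` is not a square. -/
def IsQuadNorm {K : Type*} [Field K] (a b : K) : Prop := ∃ x y : K, b = x ^ 2 - a * y ^ 2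

namespace IsQuadNorm

variable {K : Type*} [Field K] {a b c : K}

theorem mul (hb : IsQuadNorm a b) (hc : IsQuadNorm a c) : IsQuadNorm a (b * c) := by
  obtain ⟨x, y, rfl⟩ := hb
  obtain ⟨u, w, rfl⟩ := hc
  exact ⟨x * u + a * y * w, x * w + y * u, by ring⟩

theorem sq (a s : K) : IsQuadNorm a (s ^ 2) := ⟨s, 0, by ring⟩

theorem neg_self (a : K) : IsQuadNorm a (-a) := ⟨0, 1, by ring⟩

theorem of_mul_sq {s : K} (hs : s ≠ 0) (h : IsQuadNorm a (b * s ^ 2)) : IsQuadNorm a b := by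
  obtain ⟨x, y, h⟩ := h
  refine ⟨x / s, y / s, ?_⟩
  field_simp
  linear_combination h

theorem of_mul (hc0 : c ≠ 0) (hc : IsQuadNorm a c) (h : IsQuadNorm a (b * c)) :
    IsQuadNorm a b :=
  of_mul_sq hc0 (by have := h.mul hc; rwa [mul_assoc, ← pow_two] at this)

theorem left_mul_sq {s : K} (hs : s ≠ 0) (h : IsQuadNorm a b) : IsQuadNorm (a * s ^ 2) b := by
  obtain ⟨x, y, rfl⟩ := h
  exact ⟨x, y / s, by field_simp⟩

theorem of_isSquare [NeZero (2 : K)] (ha0 : a ≠ 0) (ha : IsSquare a) (b : K) :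
    IsQuadNorm a b := by
  obtain ⟨s, rfl⟩ := ha
  have hs : s ≠ 0 := fun h => ha0 (by simp [h])
  have h2 : (2 : K) ≠ 0 := NeZero.ne 2
  refine ⟨(b + 1) / 2, (b - 1) / (2 * s), ?_⟩
  field_simp
  ring

theorem iff_conic [NeZero (2 : K)] (ha : a ≠ 0) :
    IsQuadNorm a b ↔ ∃ x y z : K, ¬(x = 0 ∧ y = 0 ∧ z = 0) ∧ a * x ^ 2 + b * y ^ 2 = z ^ 2 := by
  constructor
  · rintro ⟨u, w, h⟩
    exact ⟨w, 1, u, by simp, by rw [h]; ring⟩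
  · rintro ⟨x, y, z, h0, h⟩
    by_cases hy : y = 0
    · subst hy
      have hx : x ≠ 0 := by
        rintro rfl
        refine h0 ⟨rfl, rfl, ?_⟩
        have : z ^ 2 = 0 := by rw [← h]; ring
        exact pow_eq_zero_iff two_ne_zero |>.1 this
      refine of_isSquare ha ⟨z / x, ?_⟩ b
      field_simp
      linear_combination h
    · refine ⟨z / y, x / y, ?_⟩
      field_simp
      linear_combination h

end IsQuadNorm

/-- The values of `x² - a y²` have index at most two among the nonzero elements of `K`. -/
def HasNormIndexLeTwo {K : Type*} [Field K] (a : K) : Prop :=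
  ∃ c : K, c ≠ 0 ∧ ∀ b : K, b ≠ 0 → IsQuadNorm a b ∨ IsQuadNorm a (b * c)

namespace HasNormIndexLeTwo

variable {K : Type*} [Field K] {a b : K}

theorem left_mul_sq {s : K} (hs : s ≠ 0) (h : HasNormIndexLeTwo a) :
    HasNormIndexLeTwo (a * s ^ 2) := by
  obtain ⟨c, hc, h⟩ := h
  exact ⟨c, hc, fun b hb => (h b hb).imp (IsQuadNorm.left_mul_sq hs) (IsQuadNorm.left_mul_sq hs)⟩

theorem mul_of_not (h : HasNormIndexLeTwo a) {b b' : K} (hb : b ≠ 0) (hb' : b' ≠ 0)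
    (h1 : ¬IsQuadNorm a b) (h2 : ¬IsQuadNorm a b') : IsQuadNorm a (b * b') := by
  obtain ⟨c, hc, h⟩ := h
  refine IsQuadNorm.of_mul_sq hc ?_
  have := ((h b hb).resolve_left h1).mul ((h b' hb').resolve_left h2)
  convert this using 1
  ring

end HasNormIndexLeTwo

/-! ### Squares and norms in `ℚ_[p]` -/

section Padic

variable {p : ℕ} [hp : Fact p.Prime]

theorem PadicInt.isSquare_of_norm_sub_lt {u x : ℤ_[p]} (h : ‖x ^ 2 - u‖ < ‖2 * x‖ ^ 2) :
    IsSquare u := by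
  have := hensels_lemma (p := p) (R := ℤ_[p]) (F := Polynomial.X ^ 2 - Polynomial.C u) (a := x)
    (by simpa [one_add_one_eq_two] using h)
  obtain ⟨z, hz, -⟩ := this
  refine ⟨z, ?_⟩
  simp only [map_sub, map_pow, Polynomial.aeval_X, Polynomial.aeval_C, Algebra.algebraMap_self,
    RingHom.id_apply] at hz
  linear_combination -hz

theorem Padic.exists_eq_sq_mul_unit {π b : ℚ_[p]} (hπ : ‖π‖ = (p : ℝ)⁻¹) (hb : b ≠ 0) :
    ∃ s : ℚ_[p], s ≠ 0 ∧ ∃ u : ℤ_[p], IsUnit u ∧ (b = u * s ^ 2 ∨ b = π * u * s ^ 2) := by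
  have hp0 : (p : ℝ) ≠ 0 := by exact_mod_cast hp.out.ne_zero
  have hpK : (p : ℚ_[p]) ≠ 0 := by exact_mod_cast hp.out.ne_zero
  have hπ0 : π ≠ 0 := by
    rintro rfl
    rw [norm_zero] at hπ
    exact inv_ne_zero hp0 hπ.symm
  have hnb := Padic.norm_eq_zpow_neg_valuation hb
  rcases Int.even_or_odd' b.valuation with ⟨n, hn | hn⟩
  · have hs : (p : ℚ_[p]) ^ n ≠ 0 := zpow_ne_zero _ hpK
    have hu : ‖b / ((p : ℚ_[p]) ^ n) ^ 2‖ = 1 := by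
      rw [norm_div, hnb, norm_pow, Padic.norm_p_zpow, hn, ← zpow_natCast, ← _root_.zpow_mul,
        ← zpow_sub₀ hp0]
      simp
      ring_nf
      simp
    refine ⟨_, hs, ⟨_, hu.le⟩, PadicInt.isUnit_iff.2 hu, Or.inl ?_⟩
    show b = b / ((p : ℚ_[p]) ^ n) ^ 2 * ((p : ℚ_[p]) ^ n) ^ 2
    field_simp
  · have hs : (p : ℚ_[p]) ^ n ≠ 0 := zpow_ne_zero _ hpK
    have hu : ‖b / (π * ((p : ℚ_[p]) ^ n) ^ 2)‖ = 1 := by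
      rw [norm_div, hnb, norm_mul, hπ, norm_pow, Padic.norm_p_zpow, hn, ← zpow_natCast, ← _root_.zpow_mul,
        ← _root_.zpow_neg_one, ← zpow_add₀ hp0, ← zpow_sub₀ hp0]
      simp
      ring_nf
      simp
    refine ⟨_, hs, ⟨_, hu.le⟩, PadicInt.isUnit_iff.2 hu, Or.inr ?_⟩
    show b = π * (b / (π * ((p : ℚ_[p]) ^ n) ^ 2)) * ((p : ℚ_[p]) ^ n) ^ 2
    field_simp

/-- If every unit is a norm, the norms have index at most two. -/
theorem HasNormIndexLeTwo.of_units {a : ℚ_[p]}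
    (h : ∀ u : ℤ_[p], IsUnit u → IsQuadNorm a (u : ℚ_[p])) : HasNormIndexLeTwo a := by
  have hpK : (p : ℚ_[p]) ≠ 0 := by exact_mod_cast hp.out.ne_zero
  refine ⟨p, hpK, fun b hb => ?_⟩
  obtain ⟨s, hs, u, hu, rfl | rfl⟩ := Padic.exists_eq_sq_mul_unit Padic.norm_p hb
  · exact Or.inl ((h u hu).mul (.sq a s))
  · right
    convert (h u hu).mul (.sq a (p * s)) using 1
    ring

/-- If some uniformizer is a norm and the unit norms have index at most two among the units, then
the norms have index at most two. -/
theorem HasNormIndexLeTwo.of_uniformizer {a π : ℚ_[p]} (hπ : ‖π‖ = (p : ℝ)⁻¹)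
    (hN : IsQuadNorm a π) (c : ℤ_[p]) (hc : c ≠ 0)
    (h : ∀ u : ℤ_[p], IsUnit u → IsQuadNorm a (u : ℚ_[p]) ∨ IsQuadNorm a (u * c : ℚ_[p])) :
    HasNormIndexLeTwo a := by
  refine ⟨c, PadicInt.coe_ne_zero.2 hc, fun b hb => ?_⟩
  obtain ⟨s, hs, u, hu, rfl | rfl⟩ := Padic.exists_eq_sq_mul_unit hπ hb
  · refine (h u hu).imp (fun h => h.mul (.sq a s)) fun h => ?_
    convert h.mul (.sq a s) using 1
    ring
  · refine (h u hu).imp (fun h => (hN.mul h).mul (.sq a s)) fun h => ?_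
    convert (hN.mul h).mul (.sq a s) using 1
    ring

theorem IsQuadNorm.of_padicInt_isSquare {u : ℤ_[p]} (a : ℚ_[p]) (h : IsSquare u) :
    IsQuadNorm a (u : ℚ_[p]) := by
  obtain ⟨s, rfl⟩ := h
  convert IsQuadNorm.sq a (s : ℚ_[p]) using 1
  push_cast
  ring

theorem PadicInt.toZMod_eq_zero_iff {u : ℤ_[p]} : PadicInt.toZMod u = 0 ↔ ‖u‖ < 1 := by
  rw [← RingHom.mem_ker, PadicInt.ker_toZMod, IsLocalRing.mem_maximalIdeal, PadicInt.mem_nonunits]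

theorem PadicInt.isUnit_iff_toZMod_ne_zero {u : ℤ_[p]} : IsUnit u ↔ PadicInt.toZMod u ≠ 0 := by
  rw [Ne, PadicInt.toZMod_eq_zero_iff, ← PadicInt.not_isUnit_iff, not_not]

section Odd

variable (hp2 : p ≠ 2)
include hp2

theorem PadicInt.isSquare_of_isSquare_toZMod {u : ℤ_[p]} (hu : IsUnit u)
    (h : IsSquare (PadicInt.toZMod u)) : IsSquare u := by
  obtain ⟨y, hy⟩ := h
  obtain ⟨x, rfl⟩ := ZMod.ringHom_surjective (PadicInt.toZMod (p := p)) y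
  have h2 : ‖(2 : ℤ_[p])‖ = 1 := by
    rw [← PadicInt.isUnit_iff, PadicInt.isUnit_iff_toZMod_ne_zero, map_ofNat]
    intro h
    have : (p : ℕ) ∣ 2 := by
      rw [← ZMod.natCast_eq_zero_iff]; exact_mod_cast h
    exact hp2 ((Nat.prime_dvd_prime_iff_eq hp.out Nat.prime_two).1 this)
  have hx : ‖x‖ = 1 := by
    rw [← PadicInt.isUnit_iff, PadicInt.isUnit_iff_toZMod_ne_zero]
    intro h0
    rw [PadicInt.isUnit_iff_toZMod_ne_zero, hy, h0] at hu
    simp at hu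
  apply PadicInt.isSquare_of_norm_sub_lt (x := x)
  rw [norm_mul, h2, hx]
  simp only [mul_one, one_pow]
  rw [← PadicInt.toZMod_eq_zero_iff, map_sub, map_pow, hy]
  ring

theorem IsQuadNorm.of_isUnit_padicInt {a u : ℤ_[p]} (ha : IsUnit a) (hu : IsUnit u) :
    IsQuadNorm (a : ℚ_[p]) (u : ℚ_[p]) := by
  have ha' := PadicInt.isUnit_iff_toZMod_ne_zero.1 ha
  have hu' := PadicInt.isUnit_iff_toZMod_ne_zero.1 hu
  have ha0 : (a : ℚ_[p]) ≠ 0 := PadicInt.coe_ne_zero.2 ha.ne_zero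
  obtain ⟨x, y, hxy⟩ := FiniteField.exists_root_sum_quadratic (R := ZMod p)
    (f := Polynomial.X ^ 2) (g := Polynomial.C (-PadicInt.toZMod a) * Polynomial.X ^ 2 +
      Polynomial.C 0 * Polynomial.X + Polynomial.C (-PadicInt.toZMod u))
    (Polynomial.degree_X_pow 2) (Polynomial.degree_quadratic (neg_ne_zero.2 ha'))
    (by rw [ZMod.card]; exact Nat.odd_iff.1 (hp.out.odd_of_ne_two hp2))
  obtain ⟨x, rfl⟩ := ZMod.ringHom_surjective (PadicInt.toZMod (p := p)) x
  obtain ⟨y, rfl⟩ := ZMod.ringHom_surjective (PadicInt.toZMod (p := p)) y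
  simp only [Polynomial.eval_pow, Polynomial.eval_X, Polynomial.eval_add, Polynomial.eval_mul,
    Polynomial.eval_C] at hxy
  by_cases hx : PadicInt.toZMod x = 0
  · obtain ⟨w, hw⟩ := ha.exists_right_inv
    have hw' := congrArg PadicInt.toZMod hw
    rw [map_mul, map_one] at hw'
    have hy : PadicInt.toZMod y ^ 2 = PadicInt.toZMod (-(u * w)) := by
      rw [hx] at hxy
      rw [map_neg, map_mul]
      linear_combination (-PadicInt.toZMod w) * hxy - (PadicInt.toZMod y) ^ 2 * hw'
    have hsq : IsSquare (-(u * w)) := by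
      apply PadicInt.isSquare_of_isSquare_toZMod hp2
      · exact (hu.mul (IsUnit.of_mul_eq_one a (by rw [mul_comm]; exact hw))).neg
      · exact ⟨PadicInt.toZMod y, by rw [← hy, pow_two]⟩
    obtain ⟨t, ht⟩ := hsq
    refine ⟨0, t, ?_⟩
    have h1 : u = 0 ^ 2 - a * t ^ 2 := by linear_combination (-u) * hw + (-a) * ht
    exact_mod_cast congrArg (fun z : ℤ_[p] => (z : ℚ_[p])) h1
  · have hsq : IsSquare (u + a * y ^ 2) := by
      have h1 : PadicInt.toZMod x ^ 2 = PadicInt.toZMod (u + a * y ^ 2) := by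
        simp only [map_add, map_mul, map_pow]
        linear_combination hxy
      apply PadicInt.isSquare_of_isSquare_toZMod hp2
      · rw [PadicInt.isUnit_iff_toZMod_ne_zero, ← h1]
        exact pow_ne_zero _ hx
      · exact ⟨PadicInt.toZMod x, by rw [← h1, pow_two]⟩
    obtain ⟨t, ht⟩ := hsq
    refine ⟨t, y, ?_⟩
    have h1 : u = t ^ 2 - a * y ^ 2 := by linear_combination ht
    exact_mod_cast congrArg (fun z : ℤ_[p] => (z : ℚ_[p])) h1

theorem hasNormIndexLeTwo_uniformizer_of_odd {a : ℚ_[p]} (ha : ‖a‖ = (p : ℝ)⁻¹) :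
    HasNormIndexLeTwo a := by
  have hodd : ringChar (ZMod p) ≠ 2 := by rw [ZMod.ringChar_zmod_n]; exact hp2
  obtain ⟨c, hc⟩ := FiniteField.exists_nonsquare hodd
  obtain ⟨c, rfl⟩ := ZMod.ringHom_surjective (PadicInt.toZMod (p := p)) c
  have hc0 : PadicInt.toZMod c ≠ 0 := fun h => hc (by rw [h]; exact IsSquare.zero)
  have hcu := PadicInt.isUnit_iff_toZMod_ne_zero.2 hc0
  refine .of_uniformizer (π := -a) (by rw [norm_neg, ha]) (.neg_self a) c hcu.ne_zero
    fun u hu => ?_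
  have hu0 := PadicInt.isUnit_iff_toZMod_ne_zero.1 hu
  by_cases hs : IsSquare (PadicInt.toZMod u)
  · exact Or.inl (.of_padicInt_isSquare a (PadicInt.isSquare_of_isSquare_toZMod hp2 hu hs))
  · right
    rw [← PadicInt.coe_mul]
    refine .of_padicInt_isSquare a (PadicInt.isSquare_of_isSquare_toZMod hp2 (hu.mul hcu) ?_)
    rw [map_mul, ← quadraticChar_one_iff_isSquare (mul_ne_zero hu0 hc0), map_mul,
      quadraticChar_neg_one_iff_not_isSquare.2 hs, quadraticChar_neg_one_iff_not_isSquare.2 hc]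
    rfl

end Odd

section Two

theorem PadicInt.coe_ofNat_two (n : ℕ) [n.AtLeastTwo] :
    ((OfNat.ofNat n : ℤ_[2]) : ℚ_[2]) = OfNat.ofNat n :=
  map_ofNat (PadicInt.Coe.ringHom (p := 2)) n

theorem PadicInt.toZModPow_mul_self_of_isUnit {u : ℤ_[2]} (hu : IsUnit u) :
    PadicInt.toZModPow 3 u * PadicInt.toZModPow 3 u = 1 := by
  obtain ⟨w, hw⟩ := hu.exists_right_inv
  have h := congrArg (PadicInt.toZModPow 3) hw
  rw [map_mul, map_one] at h
  have key : ∀ x y : ZMod (2 ^ 3), x * y = 1 → x * x = 1 := by decide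
  exact key _ _ h

theorem PadicInt.exists_eq_add_eight_mul {u t : ℤ_[2]}
    (h : PadicInt.toZModPow 3 u = PadicInt.toZModPow 3 t) : ∃ z, u = t + 8 * z := by
  rw [← sub_eq_zero, ← map_sub, ← RingHom.mem_ker, PadicInt.ker_toZModPow,
    Ideal.mem_span_singleton] at h
  obtain ⟨z, hz⟩ := h
  refine ⟨z, ?_⟩
  have h8 : ((2 : ℕ) : ℤ_[2]) ^ 3 = 8 := by norm_num
  rw [h8] at hz
  linear_combination hz

theorem PadicInt.norm_two_padicInt_two : ‖(2 : ℤ_[2])‖ = 2⁻¹ := by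
  simpa using PadicInt.norm_p (p := 2)

theorem PadicInt.isSquare_of_toZModPow_eq_one {u : ℤ_[2]} (h : PadicInt.toZModPow 3 u = 1) :
    IsSquare u := by
  obtain ⟨z, rfl⟩ := PadicInt.exists_eq_add_eight_mul (t := 1) (by rw [h, map_one])
  apply PadicInt.isSquare_of_norm_sub_lt (x := 1)
  have : (1 : ℤ_[2]) ^ 2 - (1 + 8 * z) = -(2 ^ 3 * z) := by ring
  rw [this, norm_neg, norm_mul, norm_pow, mul_one, PadicInt.norm_two_padicInt_two]
  have := PadicInt.norm_le_one z
  nlinarith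

theorem IsQuadNorm.of_toZModPow_eq {a : ℚ_[2]} {u t : ℤ_[2]} (hu : IsUnit u)
    (h : PadicInt.toZModPow 3 u = PadicInt.toZModPow 3 t) (ht : IsQuadNorm a (t : ℚ_[2])) :
    IsQuadNorm a (u : ℚ_[2]) := by
  have h1 := PadicInt.toZModPow_mul_self_of_isUnit hu
  have ht0 : t ≠ 0 := by
    rintro rfl
    rw [h, map_zero, mul_zero] at h1
    exact absurd h1 (by decide)
  refine .of_mul (PadicInt.coe_ne_zero.2 ht0) ht ?_
  rw [← PadicInt.coe_mul]
  exact .of_padicInt_isSquare a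
    (PadicInt.isSquare_of_toZModPow_eq_one (by rw [map_mul, ← h, h1]))

theorem PadicInt.isUnit_of_toZModPow_mul_self {u : ℤ_[2]}
    (h : PadicInt.toZModPow 3 u * PadicInt.toZModPow 3 u = 1) : IsUnit u := by
  by_contra hu
  rw [PadicInt.not_isUnit_iff, PadicInt.norm_lt_one_iff_dvd] at hu
  obtain ⟨w, rfl⟩ := hu
  have key : ∀ x : ZMod (2 ^ 3), (2 : ℕ) * x * ((2 : ℕ) * x) ≠ 1 := by decide
  rw [map_mul, map_natCast] at h
  exact key _ h

theorem HasNormIndexLeTwo.of_uniformizer_of_unit {a π : ℚ_[2]} (hπ : ‖π‖ = (2 : ℝ)⁻¹)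
    (hN : IsQuadNorm a π) {t : ℤ_[2]} (ht1 : PadicInt.toZModPow 3 t ≠ 1)
    (ht2 : PadicInt.toZModPow 3 t * PadicInt.toZModPow 3 t = 1)
    (ht : IsQuadNorm a (t : ℚ_[2])) : HasNormIndexLeTwo a := by
  have key : ∀ t : ZMod (2 ^ 3), t ≠ 1 → t * t = 1 → ∃ c, c * c = 1 ∧ ∀ b : ZMod (2 ^ 3),
      b * b = 1 → b = 1 ∨ b = t ∨ b * c = 1 ∨ b * c = t := by decide
  obtain ⟨c, hc1, hc⟩ := key _ ht1 ht2
  obtain ⟨c, rfl⟩ := ZMod.ringHom_surjective (PadicInt.toZModPow (p := 2) 3) c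
  have hcu := PadicInt.isUnit_of_toZModPow_mul_self hc1
  refine .of_uniformizer (by exact_mod_cast hπ) hN c hcu.ne_zero fun u hu => ?_
  rw [← PadicInt.coe_mul]
  rcases hc _ (PadicInt.toZModPow_mul_self_of_isUnit hu) with h | h | h | h
  · exact Or.inl (.of_padicInt_isSquare a (PadicInt.isSquare_of_toZModPow_eq_one h))
  · exact Or.inl (.of_toZModPow_eq hu h ht)
  · exact Or.inr (.of_padicInt_isSquare a
      (PadicInt.isSquare_of_toZModPow_eq_one (by rw [map_mul, h])))
  · exact Or.inr (.of_toZModPow_eq (hu.mul hcu) (by rw [map_mul, h]) ht)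

theorem hasNormIndexLeTwo_unit_two {a : ℤ_[2]} (ha : IsUnit a) :
    HasNormIndexLeTwo (a : ℚ_[2]) := by
  have hr := PadicInt.toZModPow_mul_self_of_isUnit ha
  have ha0 : (a : ℚ_[2]) ≠ 0 := PadicInt.coe_ne_zero.2 ha.ne_zero
  have cases_unit : ∀ x : ZMod (2 ^ 3), x * x = 1 → x = 1 ∨ x = 3 ∨ x = 5 ∨ x = 7 := by decide
  have h5 : PadicInt.toZModPow 3 (1 - 4 * a) = 5 := by
    have key : ∀ x : ZMod (2 ^ 3), x * x = 1 → 1 - 4 * x = 5 := by decide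
    simpa only [map_sub, map_one, map_mul, map_neg, map_add, map_ofNat] using key _ hr
  have hN5 : IsQuadNorm (a : ℚ_[2]) ((1 - 4 * a : ℤ_[2]) : ℚ_[2]) :=
    ⟨1, 2, by push_cast; rw [PadicInt.coe_ofNat_two 4]; ring⟩
  have uniformizer : ∀ t : ℤ_[2], IsUnit t → (1 - a : ℤ_[2]) = 2 * t →
      HasNormIndexLeTwo (a : ℚ_[2]) := by
    intro t ht h
    refine .of_uniformizer_of_unit (π := ((1 - a : ℤ_[2]) : ℚ_[2])) ?_
      ⟨1, 1, by push_cast; ring⟩ (t := 1 - 4 * a) (by rw [h5]; decide) (by rw [h5]; decide) hN5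
    rw [← PadicInt.norm_def, h, norm_mul, PadicInt.norm_two_padicInt_two, PadicInt.isUnit_iff.1 ht,
      mul_one]
  rcases cases_unit _ hr with h | h | h | h
  · exact .of_units fun u _ => .of_isSquare ha0
      (by obtain ⟨s, hs⟩ := PadicInt.isSquare_of_toZModPow_eq_one h
          exact ⟨s, by rw [hs, PadicInt.coe_mul]⟩) _
  · obtain ⟨z, hz⟩ := PadicInt.exists_eq_add_eight_mul (u := a) (t := 3) (by rw [h, map_ofNat])
    refine uniformizer (-(1 + 4 * z)) (PadicInt.isUnit_of_toZModPow_mul_self ?_)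
      (by rw [hz]; ring)
    have key : ∀ x : ZMod (2 ^ 3), -(1 + 4 * x) * -(1 + 4 * x) = 1 := by decide
    simpa only [map_sub, map_one, map_mul, map_neg, map_add, map_ofNat] using key (PadicInt.toZModPow 3 z)
  · have hN7 : IsQuadNorm (a : ℚ_[2]) ((4 - a : ℤ_[2]) : ℚ_[2]) := ⟨2, 1, by push_cast; rw [PadicInt.coe_ofNat_two 4]; ring⟩
    have h7 : PadicInt.toZModPow 3 (4 - a) = 7 := by
      rw [map_sub, h, map_ofNat]; decide
    refine .of_units fun u hu => ?_
    rcases cases_unit _ (PadicInt.toZModPow_mul_self_of_isUnit hu) with h' | h' | h' | h'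
    · exact .of_padicInt_isSquare _ (PadicInt.isSquare_of_toZModPow_eq_one h')
    · refine .of_toZModPow_eq hu (t := (1 - 4 * a) * (4 - a)) ?_ ?_
      · rw [h', map_mul, h5, h7]; decide
      · rw [PadicInt.coe_mul]; exact hN5.mul hN7
    · exact .of_toZModPow_eq hu (by rw [h', h5]) hN5
    · exact .of_toZModPow_eq hu (by rw [h', h7]) hN7
  · obtain ⟨z, hz⟩ := PadicInt.exists_eq_add_eight_mul (u := a) (t := 7) (by rw [h, map_ofNat])
    refine uniformizer (-(3 + 4 * z)) (PadicInt.isUnit_of_toZModPow_mul_self ?_)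
      (by rw [hz]; ring)
    have key : ∀ x : ZMod (2 ^ 3), -(3 + 4 * x) * -(3 + 4 * x) = 1 := by decide
    simpa only [map_sub, map_one, map_mul, map_neg, map_add, map_ofNat] using key (PadicInt.toZModPow 3 z)

theorem hasNormIndexLeTwo_uniformizer_two {u : ℤ_[2]} (hu : IsUnit u) :
    HasNormIndexLeTwo (2 * u : ℚ_[2]) := by
  have hr := PadicInt.toZModPow_mul_self_of_isUnit hu
  refine .of_uniformizer_of_unit (π := -(2 * u)) ?_ (.neg_self _) (t := 1 - 2 * u) ?_ ?_
    ⟨1, 1, by push_cast; rw [PadicInt.coe_ofNat_two 2]; ring⟩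
  · have h2 : ‖(2 : ℚ_[2])‖ = 2⁻¹ := by simpa using Padic.norm_p (p := 2)
    rw [norm_neg, norm_mul, h2, ← PadicInt.norm_def, PadicInt.isUnit_iff.1 hu, mul_one]
  · have key : ∀ x : ZMod (2 ^ 3), x * x = 1 → 1 - 2 * x ≠ 1 := by decide
    simpa only [map_sub, map_one, map_mul, map_neg, map_add, map_ofNat] using key _ hr
  · have key : ∀ x : ZMod (2 ^ 3), x * x = 1 → (1 - 2 * x) * (1 - 2 * x) = 1 := by decide
    simpa only [map_sub, map_one, map_mul, map_neg, map_add, map_ofNat] using key _ hr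

end Two

theorem Padic.hasNormIndexLeTwo {a : ℚ_[p]} (ha : a ≠ 0) : HasNormIndexLeTwo a := by
  obtain ⟨s, hs, u, hu, rfl | rfl⟩ := Padic.exists_eq_sq_mul_unit Padic.norm_p ha
  · refine .left_mul_sq hs ?_
    by_cases hp2 : p = 2
    · subst hp2
      exact hasNormIndexLeTwo_unit_two hu
    · exact .of_units fun v hv => .of_isUnit_padicInt hp2 hu hv
  · refine .left_mul_sq hs ?_
    by_cases hp2 : p = 2
    · subst hp2
      exact_mod_cast hasNormIndexLeTwo_uniformizer_two hu
    · refine hasNormIndexLeTwo_uniformizer_of_odd hp2 ?_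
      rw [norm_mul, Padic.norm_p, ← PadicInt.norm_def, PadicInt.isUnit_iff.1 hu, mul_one]

end Padic

/-! ### The Hilbert symbol -/

section HilbertSymbol

variable {p : ℕ} [hp : Fact p.Prime]

theorem hilbertSym_eq_one_iff {a b : ℚ} (ha : a ≠ 0) :
    hilbertSym p a b = 1 ↔ IsQuadNorm (a : ℚ_[p]) (b : ℚ_[p]) := by
  rw [IsQuadNorm.iff_conic (Rat.cast_ne_zero.2 ha), hilbertSym]
  split_ifs with h
  · simpa using h
  · simpa using h

theorem hilbertSym_comm (a b : ℚ) : hilbertSym p a b = hilbertSym p b a := by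
  have (a b : ℚ) : (∃ x y z : ℚ_[p], ¬(x = 0 ∧ y = 0 ∧ z = 0) ∧
      (a : ℚ_[p]) * x ^ 2 + (b : ℚ_[p]) * y ^ 2 = z ^ 2) →
      ∃ x y z : ℚ_[p], ¬(x = 0 ∧ y = 0 ∧ z = 0) ∧
      (b : ℚ_[p]) * x ^ 2 + (a : ℚ_[p]) * y ^ 2 = z ^ 2 := by
    rintro ⟨x, y, z, h0, h⟩
    exact ⟨y, x, z, by tauto, by rw [← h, add_comm]⟩
  unfold hilbertSym
  rw [propext ⟨this a b, this b a⟩]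

theorem hilbertSym_mul_self (a b : ℚ) : hilbertSym p a b * hilbertSym p a b = 1 :=
  Int.units_mul_self _

theorem hilbertSym_mul_right {a b c : ℚ} (ha : a ≠ 0) (hb : b ≠ 0) (hc : c ≠ 0) :
    hilbertSym p a (b * c) = hilbertSym p a b * hilbertSym p a c := by
  have hb' : (b : ℚ_[p]) ≠ 0 := Rat.cast_ne_zero.2 hb
  have hc' : (c : ℚ_[p]) ≠ 0 := Rat.cast_ne_zero.2 hc
  have hbc := hilbertSym_eq_one_iff (p := p) (b := b * c) ha
  have hB := hilbertSym_eq_one_iff (p := p) (b := b) ha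
  have hC := hilbertSym_eq_one_iff (p := p) (b := c) ha
  rw [Rat.cast_mul] at hbc
  rcases Int.units_eq_one_or (hilbertSym p a b) with h1 | h1 <;>
    rcases Int.units_eq_one_or (hilbertSym p a c) with h2 | h2
  · rw [h1, h2, mul_one, hbc]
    exact (hB.1 h1).mul (hC.1 h2)
  · rw [h1, h2, one_mul]
    refine (Int.units_ne_iff_eq_neg (v := 1)).1 fun h => ?_
    have : IsQuadNorm (a : ℚ_[p]) (c : ℚ_[p]) :=
      .of_mul hb' (hB.1 h1) (by rw [mul_comm]; exact hbc.1 h)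
    rw [hC.2 this] at h2
    exact absurd h2 (by decide)
  · rw [h1, h2, mul_one]
    refine (Int.units_ne_iff_eq_neg (v := 1)).1 fun h => ?_
    have : IsQuadNorm (a : ℚ_[p]) (b : ℚ_[p]) := .of_mul hc' (hC.1 h2) (hbc.1 h)
    rw [hB.2 this] at h1
    exact absurd h1 (by decide)
  · rw [h1, h2, hbc.2]
    · rfl
    · refine (Padic.hasNormIndexLeTwo (Rat.cast_ne_zero.2 ha)).mul_of_not hb' hc' ?_ ?_
      · rw [← hB, h1]; decide
      · rw [← hC, h2]; decide

theorem hilbertSym_mul_left {a b c : ℚ} (ha : a ≠ 0) (hb : b ≠ 0) (hc : c ≠ 0) :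
    hilbertSym p (a * b) c = hilbertSym p a c * hilbertSym p b c := by
  rw [hilbertSym_comm, hilbertSym_mul_right hc ha hb, hilbertSym_comm c, hilbertSym_comm c]

theorem hilbertSym_sq_right {a : ℚ} (ha : a ≠ 0) (s : ℚ) : hilbertSym p a (s ^ 2) = 1 := by
  rw [hilbertSym_eq_one_iff ha, Rat.cast_pow]
  exact .sq _ _

theorem hilbertSym_one_right {a : ℚ} (ha : a ≠ 0) : hilbertSym p a 1 = 1 := by
  simpa using hilbertSym_sq_right ha 1

theorem hilbertSym_one_left {a : ℚ} (ha : a ≠ 0) : hilbertSym p 1 a = 1 := by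
  rw [hilbertSym_comm, hilbertSym_one_right ha]

theorem hilbertSym_self_neg {a : ℚ} (ha : a ≠ 0) : hilbertSym p a (-a) = 1 := by
  rw [hilbertSym_eq_one_iff ha, Rat.cast_neg]
  exact .neg_self _

theorem hilbertSym_self {a : ℚ} (ha : a ≠ 0) : hilbertSym p a a = hilbertSym p a (-1) := by
  have h := hilbertSym_mul_right (p := p) ha ha (neg_ne_zero.2 one_ne_zero)
  rw [mul_neg_one, hilbertSym_self_neg ha] at h
  exact (eq_mul_inv_of_mul_eq h.symm).trans (by rw [one_mul, Int.units_inv_eq_self])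

theorem hilbertSym_pow_right {a b : ℚ} (ha : a ≠ 0) (hb : b ≠ 0) (n : ℕ) :
    hilbertSym p a (b ^ n) = hilbertSym p a b ^ n := by
  induction n with
  | zero => rw [pow_zero, pow_zero, hilbertSym_one_right ha]
  | succ n ih => rw [pow_succ, hilbertSym_mul_right ha (pow_ne_zero n hb) hb, ih, pow_succ]

theorem hilbertSym_congr_right {a b c : ℚ} (ha : a ≠ 0) (hc : c ≠ 0) (h : SqEquiv b c) :
    hilbertSym p a b = hilbertSym p a c := by
  obtain ⟨q, hq, rfl⟩ := h
  rw [hilbertSym_mul_right ha hc (pow_ne_zero 2 hq), hilbertSym_sq_right ha, mul_one]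

theorem hilbertSym_congr_left {a b c : ℚ} (ha : a ≠ 0) (hc : c ≠ 0) (h : SqEquiv b c) :
    hilbertSym p b a = hilbertSym p c a := by
  rw [hilbertSym_comm, hilbertSym_congr_right ha hc h, hilbertSym_comm]

/-- The binary relation behind the invariance of the Hasse invariant:
`⟨d, e⟩` and `⟨c, d e c⟩` are equivalent forms when `c` is represented by `⟨d, e⟩`. -/
theorem hilbertSym_binary {c d e x : ℚ} (hc : c ≠ 0) (hd : d ≠ 0) (he : e ≠ 0)
    (h : c = d * x ^ 2 + e) : hilbertSym p c (d * e * c) = hilbertSym p d e := by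
  have h1 : hilbertSym p (d * c) (e * c) = 1 := by
    rw [hilbertSym, if_pos]
    refine ⟨x, 1, c, by simp, ?_⟩
    have : d * c * x ^ 2 + e * c * 1 ^ 2 = c ^ 2 := by
      linear_combination (-c) * h
    exact_mod_cast congrArg (fun q : ℚ => (q : ℚ_[p])) this
  rw [hilbertSym_mul_left hd hc (mul_ne_zero he hc), hilbertSym_mul_right hd he hc,
    hilbertSym_mul_right hc he hc, hilbertSym_comm d c] at h1
  rw [hilbertSym_mul_right hc (mul_ne_zero hd he) hc, hilbertSym_mul_right hc hd he]
  generalize hilbertSym p c c = w, hilbertSym p c d = x, hilbertSym p c e = y,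
    hilbertSym p d e = z at *
  rcases Int.units_eq_one_or w with rfl | rfl <;> rcases Int.units_eq_one_or x with rfl | rfl <;>
    rcases Int.units_eq_one_or y with rfl | rfl <;>
    rcases Int.units_eq_one_or z with rfl | rfl <;> simp_all

end HilbertSymbol

/-! ### Equality modulo squares -/

namespace SqEquiv

theorem refl (x : ℚ) : SqEquiv x x := ⟨1, one_ne_zero, by ring⟩

theorem trans {x y z : ℚ} : SqEquiv x y → SqEquiv y z → SqEquiv x z := by
  rintro ⟨q, hq, rfl⟩ ⟨r, hr, rfl⟩
  exact ⟨r * q, mul_ne_zero hr hq, by ring⟩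

theorem mul {x y z w : ℚ} : SqEquiv x y → SqEquiv z w → SqEquiv (x * z) (y * w) := by
  rintro ⟨q, hq, rfl⟩ ⟨r, hr, rfl⟩
  exact ⟨q * r, mul_ne_zero hq hr, by ring⟩

end SqEquiv

/-! ### Hasse invariants of lists -/

/-- The `p`-adic invariant of the diagonal form whose coefficients are listed. -/
noncomputable def listHasse (p : ℕ) [Fact p.Prime] : List ℚ → ℤˣ
  | [] => 1
  | a :: l => hilbertSym p a l.prod * listHasse p l

/-- The listed diagonal forms have the same determinant modulo squares and the same Hasse
invariants. -/
def SameInvariants (L M : List ℚ) : Prop :=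
  SqEquiv L.prod M.prod ∧ ∀ (p : ℕ) [Fact p.Prime], listHasse p L = listHasse p M

theorem List.prod_ne_zero_of_forall {L : List ℚ} (h : ∀ x ∈ L, x ≠ 0) : L.prod ≠ 0 :=
  List.prod_ne_zero fun h0 => h 0 h0 rfl

namespace SameInvariants

theorem refl (L : List ℚ) : SameInvariants L L := ⟨.refl _, fun _ _ => rfl⟩

theorem trans {L M N : List ℚ} (h : SameInvariants L M) (h' : SameInvariants M N) :
    SameInvariants L N :=
  ⟨h.1.trans h'.1, fun p _ => (h.2 p).trans (h'.2 p)⟩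

theorem cons {L M : List ℚ} {a : ℚ} (ha : a ≠ 0) (hM : ∀ x ∈ M, x ≠ 0)
    (h : SameInvariants L M) : SameInvariants (a :: L) (a :: M) := by
  refine ⟨?_, fun p _ => ?_⟩
  · rw [List.prod_cons, List.prod_cons]
    exact (SqEquiv.refl a).mul h.1
  · rw [listHasse, listHasse, h.2 p,
      hilbertSym_congr_right ha (List.prod_ne_zero_of_forall hM) h.1]

theorem cons_sq_mul {L : List ℚ} {a b : ℚ} (hb : b ≠ 0) (hL : ∀ x ∈ L, x ≠ 0)
    (h : SqEquiv a b) : SameInvariants (a :: L) (b :: L) := by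
  refine ⟨?_, fun p _ => ?_⟩
  · rw [List.prod_cons, List.prod_cons]
    exact h.mul (.refl _)
  · rw [listHasse, listHasse, hilbertSym_congr_left (List.prod_ne_zero_of_forall hL) hb h]

theorem binary {L : List ℚ} {c d e x : ℚ} (hc : c ≠ 0) (hd : d ≠ 0) (he : e ≠ 0)
    (hL : ∀ x ∈ L, x ≠ 0) (h : c = d * x ^ 2 + e) :
    SameInvariants (d :: e :: L) (c :: (d * e * c) :: L) := by
  have hP := List.prod_ne_zero_of_forall hL
  refine ⟨⟨c⁻¹, inv_ne_zero hc, ?_⟩, fun p _ => ?_⟩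
  · simp only [List.prod_cons]
    field_simp
  · simp only [listHasse, List.prod_cons]
    have hde := mul_ne_zero hd he
    rw [hilbertSym_mul_right hd he hP, hilbertSym_mul_right hc (mul_ne_zero hde hc) hP,
      hilbertSym_binary hc hd he h, hilbertSym_mul_left hde hc hP, hilbertSym_mul_left hd he hP]
    have := hilbertSym_mul_self (p := p) c L.prod
    generalize hilbertSym p d e = x1, hilbertSym p d L.prod = x2, hilbertSym p e L.prod = x3,
      hilbertSym p c L.prod = x4, listHasse p L = x5 at *
    calc _ = x1 * x2 * x3 * x5 * 1 := by simp only [mul_one]; ac_rfl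
      _ = _ := by rw [← this]; ac_rfl

end SameInvariants

/-! ### Orthogonal lists of vectors -/

section OrthoList

variable {ι : Type*} [Fintype ι]

/-- The listed vectors are nonzero and pairwise orthogonal. -/
def IsOrthoList (L : List (ι → ℚ)) : Prop :=
  L.Pairwise (fun x y => x ⬝ᵥ y = 0) ∧ ∀ x ∈ L, x ≠ 0

/-- The subspace spanned by the listed vectors. -/
def listSpan (L : List (ι → ℚ)) : Submodule ℚ (ι → ℚ) := Submodule.span ℚ {x | x ∈ L}

/-- The squared lengths of the listed vectors. -/
def sqLengths (L : List (ι → ℚ)) : List ℚ := L.map fun x => x ⬝ᵥ x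

omit [Fintype ι] in
theorem listSpan_cons (v : ι → ℚ) (L : List (ι → ℚ)) :
    listSpan (v :: L) = Submodule.span ℚ {v} ⊔ listSpan L := by
  rw [listSpan, listSpan, ← Submodule.span_union]
  congr 1
  ext x
  simp

omit [Fintype ι] in
theorem mem_listSpan_cons {v w : ι → ℚ} {L : List (ι → ℚ)} :
    w ∈ listSpan (v :: L) ↔ ∃ a : ℚ, ∃ s ∈ listSpan L, w = a • v + s := by
  rw [listSpan_cons, Submodule.mem_sup]
  constructor
  · rintro ⟨y, hy, z, hz, rfl⟩
    obtain ⟨a, rfl⟩ := Submodule.mem_span_singleton.1 hy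
    exact ⟨a, z, hz, rfl⟩
  · rintro ⟨a, s, hs, rfl⟩
    exact ⟨a • v, Submodule.mem_span_singleton.2 ⟨a, rfl⟩, s, hs, rfl⟩

theorem isOrthoList_cons {v : ι → ℚ} {L : List (ι → ℚ)} :
    IsOrthoList (v :: L) ↔ v ≠ 0 ∧ (∀ x ∈ listSpan L, v ⬝ᵥ x = 0) ∧ IsOrthoList L := by
  simp only [IsOrthoList, List.pairwise_cons, List.mem_cons, forall_eq_or_imp]
  constructor
  · rintro ⟨⟨h1, h2⟩, h3, h4⟩
    refine ⟨h3, fun x hx => ?_, h2, h4⟩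
    induction hx using Submodule.span_induction with
    | mem x h => exact h1 x h
    | zero => simp
    | add x y _ _ hx hy => rw [dotProduct_add, hx, hy, add_zero]
    | smul a x _ hx => rw [dotProduct_smul, hx, smul_zero]
  · rintro ⟨h1, h2, h3, h4⟩
    exact ⟨⟨fun x hx => h2 x (Submodule.subset_span hx), h3⟩, h1, h4⟩

theorem dotProduct_self_ne_zero {v : ι → ℚ} (hv : v ≠ 0) : v ⬝ᵥ v ≠ 0 :=
  fun h => hv (dotProduct_self_eq_zero.1 h)

theorem IsOrthoList.sqLengths_ne_zero {L : List (ι → ℚ)} (h : IsOrthoList L) :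
    ∀ x ∈ sqLengths L, x ≠ 0 := by
  intro x hx
  obtain ⟨v, hv, rfl⟩ := List.mem_map.1 hx
  exact dotProduct_self_ne_zero (h.2 v hv)

/-- A nonzero vector in the span of an orthogonal list can be made the first vector of an
orthogonal list with the same span and the same invariants. -/
theorem IsOrthoList.exists_cons {L : List (ι → ℚ)} (hL : IsOrthoList L) {w : ι → ℚ}
    (hw : w ∈ listSpan L) (hw0 : w ≠ 0) :
    ∃ L', IsOrthoList (w :: L') ∧ listSpan (w :: L') = listSpan L ∧
      (w :: L').length = L.length ∧ SameInvariants (sqLengths L) (sqLengths (w :: L')) := by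
  induction L generalizing w with
  | nil =>
    simp [listSpan] at hw
    exact absurd hw hw0
  | cons v L ih =>
    obtain ⟨a, s, hs, rfl⟩ := mem_listSpan_cons.1 hw
    obtain ⟨hv, hvL, hL⟩ := isOrthoList_cons.1 hL
    by_cases hs0 : s = 0
    · subst hs0
      rw [add_zero] at hw hw0 ⊢
      have ha : a ≠ 0 := by rintro rfl; simp at hw0
      refine ⟨L, isOrthoList_cons.2 ⟨hw0, fun x hx => ?_, hL⟩, ?_, rfl, ?_⟩
      · rw [smul_dotProduct, hvL x hx, smul_zero]
      · rw [listSpan_cons, listSpan_cons, Submodule.span_singleton_smul_eq (IsUnit.mk0 a ha)]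
      · refine .cons_sq_mul (dotProduct_self_ne_zero hw0) hL.sqLengths_ne_zero
          ⟨a⁻¹, inv_ne_zero ha, ?_⟩
        simp only [smul_dotProduct, dotProduct_smul, smul_eq_mul]
        field_simp
    · obtain ⟨L', hL', hspan, hlen, hinv⟩ := ih hL hs hs0
      obtain ⟨-, hsL', hL'⟩ := isOrthoList_cons.1 hL'
      have hvs : v ⬝ᵥ s = 0 := hvL s hs
      have hsv : s ⬝ᵥ v = 0 := by rw [dotProduct_comm, hvs]
      have hvL' : ∀ x ∈ listSpan L', v ⬝ᵥ x = 0 := fun x hx =>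
        hvL x (by rw [← hspan, listSpan_cons]; exact Submodule.mem_sup_right hx)
      set d := v ⬝ᵥ v with hd
      set e := s ⬝ᵥ s with he
      set w := a • v + s with hwdef
      have hc : w ⬝ᵥ w = d * a ^ 2 + e := by
        simp only [hwdef, add_dotProduct, dotProduct_add, smul_dotProduct, dotProduct_smul, hvs,
          hsv, smul_eq_mul]
        ring
      have hd0 : d ≠ 0 := dotProduct_self_ne_zero hv
      have he0 : e ≠ 0 := dotProduct_self_ne_zero hs0
      have hc0 : w ⬝ᵥ w ≠ 0 := dotProduct_self_ne_zero hw0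
      set t := e • v - (a * d) • s with ht
      have htt : t ⬝ᵥ t = d * e * (w ⬝ᵥ w) := by
        rw [hc]
        simp only [ht, sub_dotProduct, dotProduct_sub, smul_dotProduct, dotProduct_smul, hvs,
          hsv, smul_eq_mul, ← hd, ← he]
        ring
      have hwt : w ⬝ᵥ t = 0 := by
        simp only [ht, hwdef, add_dotProduct, dotProduct_sub, smul_dotProduct, dotProduct_smul,
          hvs, hsv, smul_eq_mul, ← hd, ← he]
        ring
      have ht0 : t ≠ 0 := by
        intro h
        rw [h, zero_dotProduct] at htt
        exact mul_ne_zero (mul_ne_zero hd0 he0) hc0 htt.symm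
      have htL : IsOrthoList (t :: L') := by
        refine isOrthoList_cons.2 ⟨ht0, fun x hx => ?_, hL'⟩
        rw [ht, sub_dotProduct, smul_dotProduct, smul_dotProduct, hvL' x hx, hsL' x hx]
        simp
      refine ⟨t :: L', isOrthoList_cons.2 ⟨hw0, fun x hx => ?_, htL⟩, ?_, ?_, ?_⟩
      · obtain ⟨b, y, hy, rfl⟩ := mem_listSpan_cons.1 hx
        rw [dotProduct_add, dotProduct_smul, hwt, hwdef, add_dotProduct, smul_dotProduct,
          hvL' y hy, hsL' y hy]
        simp
      · have hvmem : v ∈ Submodule.span ℚ ({w} ∪ {t} : Set (ι → ℚ)) := by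
          have : v = (w ⬝ᵥ w)⁻¹ • ((a * d) • w + t) := by
            have h1 : (a * d) • w + t = (w ⬝ᵥ w) • v := by
              rw [hc, ht, hwdef]; module
            rw [h1, smul_smul, inv_mul_cancel₀ hc0, one_smul]
          rw [this]
          exact Submodule.smul_mem _ _ (Submodule.add_mem _
            (Submodule.smul_mem _ _ (Submodule.subset_span (by simp)))
            (Submodule.subset_span (by simp)))
        have hsmem : s ∈ Submodule.span ℚ ({w} ∪ {t} : Set (ι → ℚ)) := by
          have : s = w - a • v := by rw [hwdef]; module
          rw [this]
          exact Submodule.sub_mem _ (Submodule.subset_span (by simp))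
            (Submodule.smul_mem _ _ hvmem)
        have hspan2 : Submodule.span ℚ {w} ⊔ Submodule.span ℚ {t} =
            Submodule.span ℚ {v} ⊔ Submodule.span ℚ {s} := by
          apply le_antisymm
          · refine sup_le ?_ ?_ <;> rw [Submodule.span_singleton_le_iff_mem] <;>
              rw [Submodule.mem_sup]
            · exact ⟨a • v, Submodule.smul_mem _ _ (Submodule.mem_span_singleton_self v), s,
                Submodule.mem_span_singleton_self s, rfl⟩
            · exact ⟨e • v, Submodule.smul_mem _ _ (Submodule.mem_span_singleton_self v),
                (-(a * d)) • s, Submodule.smul_mem _ _ (Submodule.mem_span_singleton_self s),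
                by rw [ht]; module⟩
          · rw [← Submodule.span_union {w}]
            refine sup_le ?_ ?_ <;> rw [Submodule.span_singleton_le_iff_mem]
            exacts [hvmem, hsmem]
        rw [listSpan_cons, listSpan_cons, ← sup_assoc, hspan2, sup_assoc, ← listSpan_cons, hspan,
          ← listSpan_cons]
      · simpa using hlen
      · have h1 : SameInvariants (sqLengths (v :: L)) (d :: e :: sqLengths L') :=
          .cons hd0 (by
            intro x hx
            rcases List.mem_cons.1 hx with rfl | hx
            exacts [he0, hL'.sqLengths_ne_zero x hx]) hinv
        refine h1.trans ?_
        have h2 := SameInvariants.binary hc0 hd0 he0 hL'.sqLengths_ne_zero hc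
        rw [← htt] at h2
        exact h2

/-- Orthogonal lists with the same span have the same invariants. -/
theorem IsOrthoList.sameInvariants {L M : List (ι → ℚ)} (hL : IsOrthoList L)
    (hM : IsOrthoList M) (h : listSpan L = listSpan M) :
    SameInvariants (sqLengths L) (sqLengths M) := by
  induction M generalizing L with
  | nil =>
    cases L with
    | nil => exact .refl _
    | cons v L =>
      have hv : v ∈ listSpan (v :: L) := Submodule.subset_span (by simp)
      rw [h] at hv
      simp [listSpan] at hv
      exact absurd hv (isOrthoList_cons.1 hL).1
  | cons w M ih =>
    obtain ⟨hw, hwM, hM⟩ := isOrthoList_cons.1 hM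
    obtain ⟨L', hL', hspan, -, hinv⟩ := hL.exists_cons (w := w)
      (by rw [h]; exact Submodule.subset_span (by simp)) hw
    obtain ⟨-, hwL', hL'⟩ := isOrthoList_cons.1 hL'
    refine hinv.trans (.cons (dotProduct_self_ne_zero hw) hM.sqLengths_ne_zero (ih hL' hM ?_))
    have key : ∀ K K' : List (ι → ℚ), (∀ x ∈ listSpan K, w ⬝ᵥ x = 0) →
        (∀ x ∈ listSpan K', w ⬝ᵥ x = 0) → listSpan (w :: K) = listSpan (w :: K') →
        listSpan K ≤ listSpan K' := by
      intro K K' hK hK' hKK x hx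
      have hx' : x ∈ listSpan (w :: K') := by
        rw [← hKK]
        exact mem_listSpan_cons.2 ⟨0, x, hx, by simp⟩
      obtain ⟨a, s, hs, hxs⟩ := mem_listSpan_cons.1 hx'
      have h0 := hK x hx
      rw [hxs, dotProduct_add, dotProduct_smul, hK' s hs, add_zero, smul_eq_mul] at h0
      have ha : a = 0 := (mul_eq_zero.1 h0).resolve_right (dotProduct_self_ne_zero hw)
      rw [hxs, ha, zero_smul, zero_add]
      exact hs
    have h' := hspan.trans h
    exact le_antisymm (key _ _ hwL' hwM h') (key _ _ hwM hwL' h'.symm)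

theorem IsOrthoList.linearIndependent {L : List (ι → ℚ)} (hL : IsOrthoList L) :
    LinearIndependent ℚ L.get := by
  refine LinearMap.linearIndependent_of_isOrthoᵢ
    (B := (dotProductBilin ℚ ℚ : LinearMap.BilinForm ℚ (ι → ℚ))) ?_ fun i => ?_
  · intro i j hij
    show L.get i ⬝ᵥ L.get j = 0
    have := List.pairwise_iff_get.1 hL.1
    rcases lt_or_gt_of_ne hij with h | h
    · exact this i j h
    · rw [dotProduct_comm]; exact this j i h
  · exact dotProduct_self_ne_zero (hL.2 _ (List.get_mem _ _))

theorem IsOrthoList.listSpan_eq_top {L : List (ι → ℚ)} (hL : IsOrthoList L)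
    (hlen : L.length = Fintype.card ι) : listSpan L = ⊤ := by
  have h := hL.linearIndependent.span_eq_top_of_card_eq_finrank' (by simp [hlen])
  rw [← h, listSpan]
  congr 1
  ext x
  simp [List.mem_iff_get]

/-- The standard basis of `ℚ^ι` as a list. -/
noncomputable def stdList (ι : Type*) [Fintype ι] [DecidableEq ι] : List (ι → ℚ) :=
  Finset.univ.toList.map fun i => Pi.single i 1

theorem isOrthoList_stdList [DecidableEq ι] : IsOrthoList (stdList ι) := by
  constructor
  · rw [stdList, List.pairwise_map]
    refine (Finset.nodup_toList _).imp fun {i j} hij => ?_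
    simp [hij.symm]
  · intro x hx
    obtain ⟨i, -, rfl⟩ := List.mem_map.1 hx
    simp

theorem length_stdList [DecidableEq ι] : (stdList ι).length = Fintype.card ι := by
  simp [stdList]

theorem sqLengths_stdList [DecidableEq ι] :
    sqLengths (stdList ι) = List.replicate (Fintype.card ι) 1 := by
  simp [sqLengths, stdList, Function.comp_def]

theorem listHasse_replicate_one (p : ℕ) [Fact p.Prime] (n : ℕ) :
    listHasse p (List.replicate n 1) = 1 := by
  induction n with
  | zero => rfl
  | succ n ih => rw [List.replicate_succ, listHasse, ih, List.prod_replicate, one_pow,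
      hilbertSym_one_right one_ne_zero, mul_one]

/-- Orthogonal bases of `ℚ^ι` have trivial invariants. -/
theorem IsOrthoList.invariants_of_length_eq {L : List (ι → ℚ)} (hL : IsOrthoList L)
    (hlen : L.length = Fintype.card ι) : SqEquiv (sqLengths L).prod 1 ∧
      ∀ (p : ℕ) [Fact p.Prime], listHasse p (sqLengths L) = 1 := by
  classical
  have h := hL.sameInvariants isOrthoList_stdList
    (by rw [hL.listSpan_eq_top hlen, isOrthoList_stdList.listSpan_eq_top length_stdList])
  rw [sqLengths_stdList] at h
  refine ⟨by simpa using h.1, fun p _ => ?_⟩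
  rw [h.2 p, listHasse_replicate_one]

/-- Any nonzero vector is the first vector of an orthogonal basis of `ℚ^ι`. -/
theorem exists_isOrthoList_cons {w : ι → ℚ} (hw : w ≠ 0) :
    ∃ L : List (ι → ℚ), IsOrthoList (w :: L) ∧ (w :: L).length = Fintype.card ι := by
  classical
  obtain ⟨L, hL, -, hlen, -⟩ := isOrthoList_stdList.exists_cons (w := w)
    (by rw [isOrthoList_stdList.listSpan_eq_top length_stdList]; trivial) hw
  exact ⟨L, hL, hlen.trans length_stdList⟩

end OrthoList

/-! ### Sums and multiples of diagonal forms -/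

theorem listHasse_append (p : ℕ) [Fact p.Prime] {L M : List ℚ} (hL : ∀ x ∈ L, x ≠ 0)
    (hM : ∀ x ∈ M, x ≠ 0) :
    listHasse p (L ++ M) = listHasse p L * listHasse p M * hilbertSym p L.prod M.prod := by
  have hPM := List.prod_ne_zero_of_forall hM
  induction L with
  | nil => simp [listHasse, hilbertSym_one_left hPM]
  | cons a L ih =>
    have hL' : ∀ x ∈ L, x ≠ 0 := fun x hx => hL x (List.mem_cons_of_mem _ hx)
    have ha : a ≠ 0 := hL a List.mem_cons_self
    have hPL := List.prod_ne_zero_of_forall hL'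
    rw [List.cons_append, listHasse, listHasse, ih hL', List.prod_append, List.prod_cons,
      hilbertSym_mul_right ha hPL hPM, hilbertSym_mul_left ha hPL hPM]
    ac_rfl

theorem listHasse_map_mul (p : ℕ) [Fact p.Prime] {c : ℚ} (hc : c ≠ 0) {L : List ℚ}
    (hL : ∀ x ∈ L, x ≠ 0) :
    listHasse p (L.map (c * ·)) = hilbertSym p c c ^ (L.length.choose 2) *
      hilbertSym p c L.prod ^ (L.length + 1) * listHasse p L := by
  induction L with
  | nil => simp [listHasse, hilbertSym_one_right hc]
  | cons a L ih =>
    have hL' : ∀ x ∈ L, x ≠ 0 := fun x hx => hL x (List.mem_cons_of_mem _ hx)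
    have ha : a ≠ 0 := hL a List.mem_cons_self
    have hP := List.prod_ne_zero_of_forall hL'
    have hprod : (L.map (c * ·)).prod = c ^ L.length * L.prod := by
      rw [List.prod_map_mul]; simp
    rw [List.map_cons, listHasse, ih hL', hprod, listHasse, List.length_cons, List.prod_cons,
      hilbertSym_mul_left hc ha (mul_ne_zero (pow_ne_zero _ hc) hP),
      hilbertSym_mul_right hc (pow_ne_zero _ hc) hP, hilbertSym_mul_right ha (pow_ne_zero _ hc) hP,
      hilbertSym_pow_right hc hc, hilbertSym_pow_right ha hc, hilbertSym_comm a c, hilbertSym_mul_right hc ha hP,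
      Nat.choose_succ_succ' L.length 1, Nat.choose_one_right]
    have h1 := hilbertSym_mul_self (p := p) c a
    generalize hilbertSym p c a = x at *
    generalize hilbertSym p c L.prod = y at *
    have hx : x ^ (L.length + 1 + 1) = x ^ L.length := by
      rw [pow_succ, pow_succ, mul_assoc, h1, mul_one]
    rw [mul_pow, hx]
    simp only [pow_add, pow_one, Nat.reduceAdd]
    generalize hilbertSym p c c ^ L.length = u, hilbertSym p c c ^ L.length.choose 2 = w,
      x ^ L.length = x', y ^ L.length = y'
    ac_rfl

theorem diagHasse_eq_listHasse (p : ℕ) [Fact p.Prime] {n : ℕ} (d : Fin n → ℚ)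
    (hd : ∀ i, d i ≠ 0) : diagHasse p d = listHasse p (List.ofFn d) := by
  have hprod {n : ℕ} (a : ℚ) (ha : a ≠ 0) (d : Fin n → ℚ) (hd : ∀ i, d i ≠ 0) :
      ∏ i, hilbertSym p a (d i) = hilbertSym p a (∏ i, d i) := by
    induction n with
    | zero => simp [hilbertSym_one_right ha]
    | succ n ih =>
      rw [Fin.prod_univ_succ, Fin.prod_univ_succ, ih _ fun i => hd i.succ,
        hilbertSym_mul_right ha (hd 0) (Finset.prod_ne_zero_iff.2 fun i _ => hd i.succ)]
  induction n with
  | zero => simp [diagHasse, listHasse]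
  | succ n ih =>
    rw [List.ofFn_succ, listHasse, List.prod_ofFn, ← ih _ fun i => hd i.succ, diagHasse,
      Fin.prod_univ_succ, ← hprod _ (hd 0) _ fun i => hd i.succ, diagHasse]
    congr 1
    · rw [Fin.prod_Ioi_zero]
    · exact Finset.prod_congr rfl fun i _ => by rw [Fin.prod_Ioi_succ]

/-! ### The incidence matrix of a quasi-symmetric design -/

/-- The algebraic relations between the incidence matrix `N` of a quasi-symmetric design and the
adjacency matrix `A` of its block graph, which is regular of degree `a`. -/
structure IsQSIncidence {P V K : Type*} [Fintype P] [Fintype V] [Field K] [LinearOrder K]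
    (N : Matrix P V K) (A : Matrix V V K) (a ν lam k l₁ l₂ : K) : Prop where
  mulVec_transpose : ∀ y, N *ᵥ (Nᵀ *ᵥ y) = ν • y + (lam * (1 ⬝ᵥ y)) • 1
  transpose_mulVec : ∀ x,
    Nᵀ *ᵥ (N *ᵥ x) = (k - l₁) • x + (l₂ - l₁) • (A *ᵥ x) + (l₁ * (1 ⬝ᵥ x)) • 1
  transpose_mulVec_one : Nᵀ *ᵥ 1 = k • (1 : V → K)
  mulVec_one : ∃ r : K, N *ᵥ 1 = r • (1 : P → K)
  adj_one : 1 ᵥ* A = a • (1 : V → K)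
  nu_pos : 0 < ν
  lam_nonneg : 0 ≤ lam
  k_pos : 0 < k
  lt : l₁ < l₂
  nonempty : Nonempty P

namespace IsQSIncidence

variable {P V K : Type*} [Fintype P] [Fintype V] [Field K] [LinearOrder K]
  {N : Matrix P V K} {A : Matrix V V K} {a ν lam k l₁ l₂ : K}

theorem one_dotProduct_mulVec (h : IsQSIncidence N A a ν lam k l₁ l₂) (x : V → K) :
    1 ⬝ᵥ (N *ᵥ x) = k * (1 ⬝ᵥ x) := by
  rw [dotProduct_mulVec, ← Matrix.mulVec_transpose, h.transpose_mulVec_one, smul_dotProduct,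
    smul_eq_mul]

variable [IsStrictOrderedRing K]

theorem transpose_injective (h : IsQSIncidence N A a ν lam k l₁ l₂) {y : P → K}
    (hy : Nᵀ *ᵥ y = 0) : y = 0 := by
  have h1 := h.mulVec_transpose y
  rw [hy, mulVec_zero] at h1
  have h2 := congrArg (y ⬝ᵥ ·) h1
  simp only [dotProduct_zero, dotProduct_add, dotProduct_smul, smul_eq_mul,
    dotProduct_comm y 1] at h2
  have h3 : 0 ≤ y ⬝ᵥ y := by
    rw [dotProduct]; exact Finset.sum_nonneg fun i _ => mul_self_nonneg _
  have h4 : 0 ≤ lam * (1 ⬝ᵥ y) * (1 ⬝ᵥ y) := by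
    rw [mul_assoc]; exact mul_nonneg h.lam_nonneg (mul_self_nonneg _)
  have h5 : ν * (y ⬝ᵥ y) = 0 := by
    have := mul_nonneg h.nu_pos.le h3
    linarith
  exact dotProduct_self_eq_zero.1 ((mul_eq_zero.1 h5).resolve_left h.nu_pos.ne')

theorem one_dotProduct_of_mulVec_eq_zero (h : IsQSIncidence N A a ν lam k l₁ l₂) {x : V → K}
    (hx : N *ᵥ x = 0) : 1 ⬝ᵥ x = 0 := by
  have := h.one_dotProduct_mulVec x
  rw [hx, dotProduct_zero] at this
  exact (mul_eq_zero.1 this.symm).resolve_left h.k_pos.ne'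

theorem one_dotProduct_of_eigen (h : IsQSIncidence N A a ν lam k l₁ l₂) {x : V → K} {t : K}
    (hx : A *ᵥ x = t • x) (ht : t ≠ a) : 1 ⬝ᵥ x = 0 := by
  have h1 : 1 ⬝ᵥ (A *ᵥ x) = a * (1 ⬝ᵥ x) := by
    rw [dotProduct_mulVec, h.adj_one, smul_dotProduct, smul_eq_mul]
  rw [hx, dotProduct_smul, smul_eq_mul, ← sub_eq_zero, ← sub_mul] at h1
  exact (mul_eq_zero.1 h1).resolve_left (sub_ne_zero.2 ht)

theorem transpose_mulVec_of_eigen (h : IsQSIncidence N A a ν lam k l₁ l₂) {x : V → K} {t : K}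
    (hx : A *ᵥ x = t • x) (ht : t ≠ a) :
    Nᵀ *ᵥ (N *ᵥ x) = ((k - l₁) + (l₂ - l₁) * t) • x := by
  rw [h.transpose_mulVec, h.one_dotProduct_of_eigen hx ht, hx]
  module

theorem eigenvalue_eq (h : IsQSIncidence N A a ν lam k l₁ l₂) {x : V → K} {t : K}
    (hx : A *ᵥ x = t • x) (hx0 : x ≠ 0) (ht : t ≠ a) :
    (k - l₁) + (l₂ - l₁) * t = 0 ∨ (k - l₁) + (l₂ - l₁) * t = ν := by
  have h1 := h.transpose_mulVec_of_eigen hx ht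
  have h2 := h.mulVec_transpose (N *ᵥ x)
  rw [h1, h.one_dotProduct_mulVec, h.one_dotProduct_of_eigen hx ht, mulVec_smul, mul_zero,
    mul_zero, zero_smul, add_zero, ← sub_eq_zero, ← sub_smul, smul_eq_zero] at h2
  rcases h2 with h2 | h2
  · exact Or.inr (sub_eq_zero.1 h2)
  · rw [h2, mulVec_zero] at h1
    exact Or.inl ((smul_eq_zero.1 h1.symm).resolve_right hx0)

/-- The two eigenvalues other than the degree are determined by the design. -/
theorem eigenvalues_eq (h : IsQSIncidence N A a ν lam k l₁ l₂) {x y : V → K} {σ ρ : K}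
    (hx : A *ᵥ x = σ • x) (hx0 : x ≠ 0) (hσ : σ ≠ a)
    (hy : A *ᵥ y = ρ • y) (hy0 : y ≠ 0) (hρ : ρ ≠ a) (hlt : σ < ρ) :
    (k - l₁) + (l₂ - l₁) * σ = 0 ∧ (k - l₁) + (l₂ - l₁) * ρ = ν := by
  have h1 : (l₂ - l₁) * σ < (l₂ - l₁) * ρ := mul_lt_mul_of_pos_left hlt (sub_pos.2 h.lt)
  have hν := h.nu_pos
  rcases h.eigenvalue_eq hx hx0 hσ with h2 | h2 <;> rcases h.eigenvalue_eq hy hy0 hρ with h3 | h3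
  · linarith
  · exact ⟨h2, h3⟩
  · linarith
  · linarith

theorem mulVec_eq_smul_iff (h : IsQSIncidence N A a ν lam k l₁ l₂) {σ : K} (hσ : σ ≠ a)
    (h0 : (k - l₁) + (l₂ - l₁) * σ = 0) (x : V → K) : A *ᵥ x = σ • x ↔ N *ᵥ x = 0 := by
  constructor
  · intro hx
    have h1 := h.transpose_mulVec_of_eigen hx hσ
    rw [h0, zero_smul] at h1
    exact h.transpose_injective h1
  · intro hx
    have h1 := h.transpose_mulVec x
    rw [h.one_dotProduct_of_mulVec_eq_zero hx, hx, mulVec_zero, mul_zero, zero_smul, add_zero] at h1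
    have h2 : (l₂ - l₁) • (A *ᵥ x - σ • x) = 0 := by
      calc _ = (k - l₁) • x + (l₂ - l₁) • A *ᵥ x - ((k - l₁) + (l₂ - l₁) * σ) • x := by module
        _ = 0 := by rw [← h1, h0, zero_smul, sub_zero]
    exact sub_eq_zero.1 ((smul_eq_zero.1 h2).resolve_left (sub_pos.2 h.lt).ne')

theorem finrank_ker (h : IsQSIncidence N A a ν lam k l₁ l₂) :
    Fintype.card P + Module.finrank K (LinearMap.ker N.mulVecLin) = Fintype.card V := by
  have h1 := LinearMap.finrank_range_add_finrank_ker N.mulVecLin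
  have h2 : N.rank = Fintype.card P := by
    rw [← rank_transpose, Matrix.rank, LinearMap.finrank_range_of_inj, Module.finrank_fintype_fun_eq_card]
    refine (injective_iff_map_eq_zero _).2 fun y hy => h.transpose_injective hy
  rw [Matrix.rank] at h2
  rw [h2, Module.finrank_fintype_fun_eq_card] at h1
  exact h1

theorem finrank_eigenspace_sigma [DecidableEq V] (h : IsQSIncidence N A a ν lam k l₁ l₂) {σ : K}
    (hσ : σ ≠ a) (h0 : (k - l₁) + (l₂ - l₁) * σ = 0) :
    Fintype.card P + Module.finrank K (Module.End.eigenspace (toLin' A) σ) = Fintype.card V := by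
  have heq : Module.End.eigenspace (toLin' A) σ = LinearMap.ker N.mulVecLin := by
    ext x
    rw [Module.End.mem_eigenspace_iff, toLin'_apply, h.mulVec_eq_smul_iff hσ h0]
    simp
  rw [heq, h.finrank_ker]

theorem finrank_eigenspace_rho [DecidableEq V] (h : IsQSIncidence N A a ν lam k l₁ l₂) {ρ : K}
    (hρ : ρ ≠ a) (h0 : (k - l₁) + (l₂ - l₁) * ρ = ν) :
    Module.finrank K (Module.End.eigenspace (toLin' A) ρ) + 1 = Fintype.card P := by
  classical
  let φ : (P → K) →ₗ[K] K := dotProductBilin K K 1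
  have hφ (y : P → K) : φ y = 1 ⬝ᵥ y := rfl
  have hinj : Function.Injective Nᵀ.mulVecLin :=
    (injective_iff_map_eq_zero _).2 fun y hy => h.transpose_injective hy
  have heq : Module.End.eigenspace (toLin' A) ρ = (LinearMap.ker φ).map Nᵀ.mulVecLin := by
    ext x
    rw [Module.End.mem_eigenspace_iff, toLin'_apply, Submodule.mem_map]
    constructor
    · intro hx
      refine ⟨ν⁻¹ • (N *ᵥ x), ?_, ?_⟩
      · rw [LinearMap.mem_ker, map_smul, hφ, h.one_dotProduct_mulVec,
          h.one_dotProduct_of_eigen hx hρ, mul_zero, smul_zero]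
      · rw [mulVecLin_apply, mulVec_smul, h.transpose_mulVec_of_eigen hx hρ, h0, smul_smul,
          inv_mul_cancel₀ h.nu_pos.ne', one_smul]
    · rintro ⟨y, hy, rfl⟩
      rw [LinearMap.mem_ker, hφ] at hy
      rw [mulVecLin_apply]
      obtain ⟨r, hr⟩ := h.mulVec_one
      have h1 := h.transpose_mulVec (Nᵀ *ᵥ y)
      have h2 : 1 ⬝ᵥ (Nᵀ *ᵥ y) = 0 := by
        rw [dotProduct_mulVec, vecMul_transpose, hr, smul_dotProduct, hy, smul_zero]
      rw [h2, h.mulVec_transpose, hy, mul_zero, zero_smul, add_zero, mul_zero, zero_smul, add_zero,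
        mulVec_smul] at h1
      have h3 : (l₂ - l₁) • (A *ᵥ (Nᵀ *ᵥ y) - ρ • (Nᵀ *ᵥ y)) = 0 := by
        calc _ = (k - l₁) • (Nᵀ *ᵥ y) + (l₂ - l₁) • (A *ᵥ (Nᵀ *ᵥ y)) -
              ((k - l₁) + (l₂ - l₁) * ρ) • (Nᵀ *ᵥ y) := by module
          _ = 0 := by rw [← h1, h0, sub_self]
      exact sub_eq_zero.1 ((smul_eq_zero.1 h3).resolve_left (sub_pos.2 h.lt).ne')
  have hsurj : LinearMap.range φ = ⊤ := by
    obtain ⟨i⟩ := h.nonempty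
    refine LinearMap.range_eq_top.2 fun c => ⟨Pi.single i c, ?_⟩
    rw [hφ]
    simp
  have h1 := LinearMap.finrank_range_add_finrank_ker φ
  rw [hsurj, finrank_top, Module.finrank_self, Module.finrank_fintype_fun_eq_card] at h1
  rw [heq, (Submodule.equivMapOfInjective _ hinj (LinearMap.ker φ)).finrank_eq.symm, add_comm, h1]

end IsQSIncidence

/-- The incidence matrix of a family of blocks. -/
def incidenceMatrix {P V : Type*} [DecidableEq P] (K : Type*) [Zero K] [One K] (B : V → Finset P) :
    Matrix P V K := of fun x i => if x ∈ B i then 1 else 0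

theorem of_one_mulVec {m n K : Type*} [Fintype n] [CommRing K] (x : n → K) :
    (of fun (_ : m) (_ : n) => (1 : K)) *ᵥ x = (1 ⬝ᵥ x) • 1 := by
  ext i
  simp [mulVec, dotProduct]

section Design

variable {P V : Type*} [Fintype P] [DecidableEq P] [Fintype V]
  {B : V → Finset P} {v k lam r l₁ l₂ ν : ℕ}

theorem incidenceMatrix_mul_transpose (K : Type*) [CommRing K] (hB : IsTwoDesign B v k lam)
    (hr : HasReplication B r) (hrν : r = lam + ν) :
    incidenceMatrix K B * (incidenceMatrix K B)ᵀ =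
      (ν : K) • (1 : Matrix P P K) + (lam : K) • of fun _ _ => 1 := by
  ext x y
  have h1 : (incidenceMatrix K B * (incidenceMatrix K B)ᵀ) x y =
      ((Finset.univ.filter fun i => x ∈ B i ∧ y ∈ B i).card : K) := by
    rw [mul_apply, Finset.card_filter, Nat.cast_sum]
    refine Finset.sum_congr rfl fun i _ => ?_
    simp only [incidenceMatrix, of_apply, transpose_apply]
    split_ifs <;> simp_all
  rw [h1]
  by_cases hxy : x = y
  · subst hxy
    have := hr x
    simp only [and_self, this, hrν]
    simp
    ring
  · rw [hB.balance x y hxy]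
    simp [hxy]

theorem incidenceMatrix_transpose_mul [DecidableEq V] (K : Type*) [CommRing K] (hB : IsTwoDesign B v k lam)
    (hI : intersectionNumbers B = {l₁, l₂}) {G : SimpleGraph V} [DecidableRel G.Adj]
    (hG : ∀ i j, G.Adj i j ↔ i ≠ j ∧ (B i ∩ B j).card = l₂) :
    (incidenceMatrix K B)ᵀ * incidenceMatrix K B =
      ((k : K) - l₁) • (1 : Matrix V V K) + ((l₂ : K) - l₁) • G.adjMatrix K +
        (l₁ : K) • of fun _ _ => 1 := by
  ext i j
  have h1 : ((incidenceMatrix K B)ᵀ * incidenceMatrix K B) i j = ((B i ∩ B j).card : K) := by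
    rw [mul_apply, ← Finset.filter_mem_eq_inter, ← Finset.filter_univ_mem (B i),
      Finset.filter_filter, Finset.card_filter, Nat.cast_sum]
    refine Finset.sum_congr rfl fun x _ => ?_
    simp only [incidenceMatrix, of_apply, transpose_apply]
    split_ifs <;> simp_all
  rw [h1]
  by_cases hij : i = j
  · subst hij
    simp [hB.card_block i]
  · by_cases hl : (B i ∩ B j).card = l₂
    · have : G.Adj i j := (hG i j).2 ⟨hij, hl⟩
      simp [hij, hl, this]
    · have hn : ¬G.Adj i j := fun h => hl ((hG i j).1 h).2
      have hmem : (B i ∩ B j).card ∈ intersectionNumbers B := ⟨i, j, hij, rfl⟩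
      rw [hI] at hmem
      have : (B i ∩ B j).card = l₁ := by
        rcases hmem with h | h
        exacts [h, absurd h hl]
      simp [hij, this, hn]

theorem isQSIncidence_incidenceMatrix [DecidableEq V] (K : Type*) [Field K] [LinearOrder K]
    [IsStrictOrderedRing K] (hB : IsTwoDesign B v k lam) (hr : HasReplication B r)
    (hrν : r = lam + ν) (hν : 0 < ν) (hlt : l₁ < l₂) (hI : intersectionNumbers B = {l₁, l₂})
    {G : SimpleGraph V} [DecidableRel G.Adj]
    (hG : ∀ i j, G.Adj i j ↔ i ≠ j ∧ (B i ∩ B j).card = l₂) {a : ℕ}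
    (ha : G.IsRegularOfDegree a) :
    IsQSIncidence (incidenceMatrix K B) (G.adjMatrix K) (a : K) ν lam k l₁ l₂ := by
  obtain ⟨i, j, -, hij⟩ : l₂ ∈ intersectionNumbers B := by rw [hI]; simp
  have hpos : 0 < (B i ∩ B j).card := by omega
  obtain ⟨x, hx⟩ := Finset.card_pos.1 hpos
  refine
    { mulVec_transpose := fun y => ?_
      transpose_mulVec := fun x => ?_
      transpose_mulVec_one := ?_
      mulVec_one := ⟨r, ?_⟩
      adj_one := ?_
      nu_pos := by exact_mod_cast hν
      lam_nonneg := by positivity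
      k_pos := ?_
      lt := by exact_mod_cast hlt
      nonempty := ⟨x⟩ }
  · rw [mulVec_mulVec, incidenceMatrix_mul_transpose K hB hr hrν, add_mulVec, smul_mulVec,
      smul_mulVec, one_mulVec, of_one_mulVec, smul_smul]
  · rw [mulVec_mulVec, incidenceMatrix_transpose_mul K hB hI hG, add_mulVec, add_mulVec,
      smul_mulVec, smul_mulVec, smul_mulVec, one_mulVec, of_one_mulVec, smul_smul]
  · ext i
    simp [incidenceMatrix, mulVec, dotProduct, hB.card_block]
  · ext x
    have := hr x
    simp [incidenceMatrix, mulVec, dotProduct, this]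
  · ext i
    rw [← mulVec_transpose, SimpleGraph.transpose_adjMatrix, SimpleGraph.adjMatrix_mulVec_apply]
    simp [ha i]
  · have : (B i ∩ B j).card ≤ (B i).card := Finset.card_le_card Finset.inter_subset_left
    rw [hB.card_block] at this
    exact_mod_cast (show 0 < k by omega)

end Design

/-! ### The idempotent of an eigenspace -/

section EigProj

variable {V : Type*} [Fintype V] [DecidableEq V] (G : SimpleGraph V) [DecidableRel G.Adj] (σ : ℤ)

theorem eigProj_mulVec (x : V → ℚ) : eigProj G σ *ᵥ x =
    Submodule.projection _ _ (isCompl_dotProduct_orthogonal (eigSpace G σ)) x := by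
  rw [eigProj, ← toLin'_apply, toLin'_toMatrix']

theorem eigProj_mulVec_mem (x : V → ℚ) : eigProj G σ *ᵥ x ∈ eigSpace G σ := by
  rw [eigProj_mulVec]
  exact Submodule.projection_apply_mem _ _

theorem dotProduct_eigProj_mulVec {w : V → ℚ} (hw : w ∈ eigSpace G σ) (x : V → ℚ) :
    w ⬝ᵥ (eigProj G σ *ᵥ x) = w ⬝ᵥ x := by
  have h := isCompl_dotProduct_orthogonal (eigSpace G σ)
  have h1 := Submodule.projection_add_projection_eq_self h x
  have h2 : w ⬝ᵥ (Submodule.projection _ _ h.symm x) = 0 :=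
    Submodule.projection_apply_mem h.symm x w hw
  conv_rhs => rw [← h1]
  rw [eigProj_mulVec, dotProduct_add, h2, add_zero]

theorem eigProj_col_dotProduct (i j : V) :
    (eigProj G σ).col i ⬝ᵥ (eigProj G σ).col j = eigProj G σ i j := by
  rw [← mulVec_single_one, ← mulVec_single_one, dotProduct_comm,
    dotProduct_eigProj_mulVec G σ (eigProj_mulVec_mem G σ _), dotProduct_single_one,
    mulVec_single_one, col_apply]

theorem eigProj_col_mem (i : V) : (eigProj G σ).col i ∈ eigSpace G σ := by
  rw [← mulVec_single_one]
  exact eigProj_mulVec_mem G σ _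

theorem span_eigProj_col : Submodule.span ℚ (Set.range (eigProj G σ).col) = eigSpace G σ := by
  rw [← range_mulVecLin]
  have : (eigProj G σ).mulVecLin =
      Submodule.projection _ _ (isCompl_dotProduct_orthogonal (eigSpace G σ)) :=
    LinearMap.ext (eigProj_mulVec G σ)
  rw [this, Submodule.range_projection]

/-- The columns of the idempotent indexed by `e`. -/
noncomputable def eigProjCols {g : ℕ} (e : Fin g ↪ V) : Matrix V (Fin g) ℚ :=
  (eigProj G σ).submatrix id e

theorem principalSub_eq {g : ℕ} (e : Fin g ↪ V) :
    principalSub G σ e = (eigProjCols G σ e)ᵀ * eigProjCols G σ e := by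
  ext i j
  exact (eigProj_col_dotProduct G σ (e i) (e j)).symm

theorem principalSub_isSymm {g : ℕ} (e : Fin g ↪ V) : (principalSub G σ e).IsSymm := by
  rw [principalSub_eq, IsSymm, transpose_mul, transpose_transpose]

/-- A nonsingular principal submatrix of size the rank exists. -/
theorem exists_principalSub_det_ne_zero {g : ℕ} (hg : Module.finrank ℚ (eigSpace G σ) = g) :
    ∃ e : Fin g ↪ V, (principalSub G σ e).det ≠ 0 := by
  rw [← span_eigProj_col] at hg
  subst hg
  obtain ⟨c, hc, -, hli⟩ := Submodule.exists_fun_fin_finrank_span_eq ℚ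
    (Set.range (eigProj G σ).col)
  choose e he using hc
  refine ⟨⟨e, fun i j hij => hli.injective (by rw [← he i, ← he j, hij])⟩, fun hdet => ?_⟩
  obtain ⟨z, hz, hz0⟩ := exists_mulVec_eq_zero_iff.2 hdet
  set C := eigProjCols G σ ⟨e, fun i j hij => hli.injective (by rw [← he i, ← he j, hij])⟩
  rw [principalSub_eq, ← mulVec_mulVec] at hz0
  have h1 : (C *ᵥ z) ⬝ᵥ (C *ᵥ z) = 0 := by
    rw [dotProduct_mulVec, ← Matrix.mulVec_transpose, hz0, zero_dotProduct]
  have h2 := dotProduct_self_eq_zero.1 h1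
  rw [mulVec_eq_sum] at h2
  refine hz (funext fun i => Fintype.linearIndependent_iff.1 hli z ?_ i)
  rw [← h2]
  refine Finset.sum_congr rfl fun i _ => ?_
  rw [← he i, op_smul_eq_smul]
  rfl

end EigProj

/-! ### The invariants of a quasi-symmetric design -/

/-- The comparison of invariants, in terms of the determinants and Hasse invariants involved. -/
theorem sqEquiv_of_decomposition {D b v ν Y κ : ℚ} {f : ℕ} (hD : D ≠ 0) (hb : b ≠ 0)
    (hY : Y ≠ 0) (hκ : κ ≠ 0) (h1 : SqEquiv (v * Y) 1)
    (h2 : SqEquiv (D * (κ ^ 2 * b * (ν ^ f * Y))) 1) : SqEquiv (ν ^ f) (v * b * D) := by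
  obtain ⟨q, hq, h1⟩ := h1
  obtain ⟨s, hs, h2⟩ := h2
  refine ⟨s / (D * κ * b * q), by positivity, ?_⟩
  have hv : v ≠ 0 := by rintro rfl; simp at h1; exact pow_ne_zero 2 hq h1.symm
  have hv' : v = q ^ 2 / Y := by field_simp; linear_combination h1
  rw [hv']
  field_simp
  linear_combination h2

theorem hasse_identity_of_decomposition {p : ℕ} [Fact p.Prime] {D b v ν Y κ : ℚ} {f : ℕ}
    (hD : D ≠ 0) (hb : b ≠ 0) (hv : v ≠ 0) (hν : ν ≠ 0) (hY : Y ≠ 0) (hκ : κ ≠ 0)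
    (h1 : SqEquiv (v * Y) 1) (h2 : SqEquiv (D * (κ ^ 2 * b * (ν ^ f * Y))) 1) {H HY : ℤˣ}
    (e1 : hilbertSym p v Y * HY = 1)
    (e2 : H * (hilbertSym p (κ ^ 2 * b) (ν ^ f * Y) * (hilbertSym p ν ν ^ (f.choose 2) *
      hilbertSym p ν Y ^ (f + 1) * HY)) * hilbertSym p D (κ ^ 2 * b * (ν ^ f * Y)) = 1) :
    hilbertSym p (-1) ν ^ (f.choose 2) * hilbertSym p ν v =
      hilbertSym p b (-v) * hilbertSym p (-(v * b)) D * H := by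
  have hνf : ν ^ f ≠ 0 := pow_ne_zero _ hν
  have hm1 : (-1 : ℚ) ≠ 0 := by norm_num
  have hsq := sqEquiv_of_decomposition hD hb hY hκ h1 h2
  have hYv : SqEquiv Y v := by
    obtain ⟨q, hq, h⟩ := h1
    exact ⟨q / v, div_ne_zero hq hv, by field_simp; linear_combination h⟩
  have hTD : SqEquiv (κ ^ 2 * b * (ν ^ f * Y)) D := by
    obtain ⟨q, hq, h⟩ := h2
    exact ⟨q / D, div_ne_zero hq hD, by field_simp; linear_combination h⟩
  have hT : SqEquiv (ν ^ f * Y) (b * D) := by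
    obtain ⟨q, hq, h⟩ := h2
    exact ⟨q / (κ * b * D), by positivity, by field_simp; linear_combination h⟩
  rw [hilbertSym_congr_right hD hD hTD, hilbertSym_self hD,
    hilbertSym_congr_left (mul_ne_zero hνf hY) hb ⟨κ, hκ, mul_comm _ _⟩,
    hilbertSym_congr_right hb (mul_ne_zero hb hD) hT, hilbertSym_mul_right hb hb hD,
    hilbertSym_self hb, hilbertSym_self hν, hilbertSym_congr_right hν hv hYv, pow_succ,
    hilbertSym_comm ν v, ← hilbertSym_pow_right hv hν,
    hilbertSym_congr_right hv (mul_ne_zero (mul_ne_zero hv hb) hD) hsq,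
    hilbertSym_mul_right hv (mul_ne_zero hv hb) hD, hilbertSym_mul_right hv hv hb,
    hilbertSym_self hv] at e2
  rw [hilbertSym_congr_right hv hv hYv, hilbertSym_self hv] at e1
  have e3 : hilbertSym p b (-v) = hilbertSym p b (-1) * hilbertSym p v b := by
    rw [← neg_one_mul, hilbertSym_mul_right hb hm1 hv, hilbertSym_comm b v]
  have e4 : hilbertSym p (-(v * b)) D =
      hilbertSym p D (-1) * hilbertSym p v D * hilbertSym p b D := by
    rw [← neg_one_mul, hilbertSym_mul_left hm1 (mul_ne_zero hv hb) hD,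
      hilbertSym_mul_left hv hb hD, hilbertSym_comm (-1)]
    ac_rfl
  rw [e3, e4, hilbertSym_comm (-1), hilbertSym_comm ν v]
  generalize hilbertSym p ν (-1) ^ f.choose 2 = x1, hilbertSym p v ν = x2,
    hilbertSym p b (-1) = x3, hilbertSym p v b = x4, hilbertSym p D (-1) = x5,
    hilbertSym p v D = x6, hilbertSym p b D = x7, hilbertSym p v (-1) = x8 at *
  have key : x1 * x2 * (x3 * x4 * (x5 * x6 * x7) * H) = 1 := by
    calc _ = x1 * x2 * (x3 * x4 * (x5 * x6 * x7) * H) * (x8 * HY) := by rw [e1, mul_one]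
      _ = 1 := by rw [← e2]; ac_rfl
  rw [eq_comm, ← Int.units_inv_eq_self (x1 * x2)]
  exact eq_inv_of_mul_eq_one_right key

theorem IsQSIncidence.transpose_dotProduct_transpose {P V : Type*} [Fintype P] [Fintype V]
    {N : Matrix P V ℚ} {A : Matrix V V ℚ} {a ν lam k l₁ l₂ : ℚ} (h : IsQSIncidence N A a ν lam k l₁ l₂) {x y : P → ℚ} (hy : 1 ⬝ᵥ y = 0) :
    (Nᵀ *ᵥ x) ⬝ᵥ (Nᵀ *ᵥ y) = ν * (x ⬝ᵥ y) := by
  rw [dotProduct_comm, dotProduct_mulVec, vecMul_transpose, h.mulVec_transpose, hy, mul_zero,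
    zero_smul, add_zero, smul_dotProduct, smul_eq_mul, dotProduct_comm]

section Main

variable {P V : Type*} [Fintype P] [Fintype V] [DecidableEq V] {G : SimpleGraph V}
  [DecidableRel G.Adj] {N : Matrix P V ℚ} {a ν lam k l₁ l₂ : ℚ} {σ : ℤ}

/-- The orthogonal decomposition of `ℚ^V` into the `σ`-eigenspace and the row space of `N`. -/
theorem IsQSIncidence.exists_decomposition
    (h : IsQSIncidence N (G.adjMatrix ℚ) a ν lam k l₁ l₂) (hσ : (σ : ℚ) ≠ a)
    (h0 : (k - l₁) + (l₂ - l₁) * σ = 0) {f g : ℕ} (hf : f + 1 = Fintype.card P)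
    (hg : Fintype.card P + g = Fintype.card V) (e : Fin g ↪ V) {d : Fin g → ℚ}
    (hd : ∀ i, d i ≠ 0) (hrat : RatEquiv (principalSub G σ e) (diagonal d)) :
    ∃ L : List ℚ, L.length = f ∧ (∀ x ∈ L, x ≠ 0) ∧ SqEquiv (((f : ℚ) + 1) * L.prod) 1 ∧
      SqEquiv ((∏ i, d i) * (k ^ 2 * ((f : ℚ) + g + 1) * (ν ^ f * L.prod))) 1 ∧
      ∀ (p : ℕ) [Fact p.Prime], hilbertSym p ((f : ℚ) + 1) L.prod * listHasse p L = 1 ∧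
        diagHasse p d * (hilbertSym p (k ^ 2 * ((f : ℚ) + g + 1)) (ν ^ f * L.prod) *
          (hilbertSym p ν ν ^ (f.choose 2) * hilbertSym p ν L.prod ^ (f + 1) * listHasse p L)) *
          hilbertSym p (∏ i, d i) (k ^ 2 * ((f : ℚ) + g + 1) * (ν ^ f * L.prod)) = 1 := by
  obtain ⟨X, -, hX⟩ := hrat
  have := h.nonempty
  obtain ⟨L, hL, hlen⟩ := exists_isOrthoList_cons (ι := P) (w := 1) one_ne_zero
  obtain ⟨-, hL1, hL'⟩ := isOrthoList_cons.1 hL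
  have hL1 : ∀ x ∈ L, 1 ⬝ᵥ x = 0 := fun x hx => hL1 x (Submodule.subset_span hx)
  have hlenL : L.length = f := by simp only [List.length_cons] at hlen; omega
  have hP : ((1 : P → ℚ) ⬝ᵥ 1) = (f : ℚ) + 1 := by
    rw [one_dotProduct_one, ← hf]; push_cast; ring
  have hV : ((1 : V → ℚ) ⬝ᵥ 1) = (f : ℚ) + g + 1 := by
    rw [one_dotProduct_one, ← hg, ← hf]; push_cast; ring
  set U := eigProjCols G σ e * X with hU
  have hUU (i j : Fin g) : Uᵀ i ⬝ᵥ Uᵀ j = diagonal d i j := by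
    rw [hX, principalSub_eq, hU]
    have : Xᵀ * ((eigProjCols G σ e)ᵀ * eigProjCols G σ e) * X =
        (eigProjCols G σ e * X)ᵀ * (eigProjCols G σ e * X) := by
      rw [transpose_mul]; simp only [Matrix.mul_assoc]
    rw [this]
    rfl
  have hNU (i : Fin g) : N *ᵥ Uᵀ i = 0 := by
    have hN : N * eigProjCols G σ e = 0 := by
      ext x j
      have hmem := eigProj_col_mem G σ (e j)
      rw [eigSpace, Module.End.mem_eigenspace_iff, toLin'_apply,
        h.mulVec_eq_smul_iff hσ h0] at hmem
      exact congrFun hmem x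
    have hNU : N * U = 0 := by rw [hU, ← Matrix.mul_assoc, hN, Matrix.zero_mul]
    ext x
    exact congrFun (congrFun hNU x) i
  have hM : IsOrthoList (List.ofFn (fun i => Uᵀ i) ++ ((1 :: L).map fun y => Nᵀ *ᵥ y)) := by
    constructor
    · rw [List.pairwise_append]
      refine ⟨?_, ?_, ?_⟩
      · rw [List.pairwise_ofFn]
        intro i j hij
        rw [hUU, diagonal_apply_ne _ hij.ne]
      · rw [List.pairwise_map, List.pairwise_cons]
        refine ⟨fun y hy => ?_, hL'.1.imp_of_mem fun {x y} _ hy hxy => ?_⟩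
        · rw [h.transpose_dotProduct_transpose (hL1 y hy), hL1 y hy, mul_zero]
        · rw [h.transpose_dotProduct_transpose (hL1 y hy), hxy, mul_zero]
      · intro u hu w hw
        obtain ⟨i, rfl⟩ := List.mem_ofFn.1 hu
        obtain ⟨y, -, rfl⟩ := List.mem_map.1 hw
        rw [dotProduct_mulVec, vecMul_transpose, hNU, zero_dotProduct]
    · intro u hu
      rcases List.mem_append.1 hu with hu | hu
      · obtain ⟨i, rfl⟩ := List.mem_ofFn.1 hu
        intro h
        have := hUU i i
        rw [h, zero_dotProduct, diagonal_apply_eq] at this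
        exact hd i this.symm
      · obtain ⟨y, hy, rfl⟩ := List.mem_map.1 hu
        exact fun h0 => hL.2 y hy (h.transpose_injective h0)
  have hMlen : (List.ofFn (fun i => Uᵀ i) ++ ((1 :: L).map fun y => Nᵀ *ᵥ y)).length =
      Fintype.card V := by
    rw [List.length_append, List.length_ofFn, List.length_map, hlen, add_comm, hg]
  have hMsq : sqLengths (List.ofFn (fun i => Uᵀ i) ++ ((1 :: L).map fun y => Nᵀ *ᵥ y)) =
      List.ofFn d ++ (k ^ 2 * ((f : ℚ) + g + 1)) :: (sqLengths L).map (ν * ·) := by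
    simp only [sqLengths, List.map_append, List.map_ofFn, List.map_cons, List.map_map]
    congr 2
    · ext i
      simp [hUU]
    · rw [h.transpose_mulVec_one, smul_dotProduct, dotProduct_smul, hV, smul_eq_mul, smul_eq_mul]
      ring
    · refine List.map_congr_left fun y hy => ?_
      exact h.transpose_dotProduct_transpose (hL1 y hy)
  have hLne := hL'.sqLengths_ne_zero
  have hν := h.nu_pos.ne'
  have hνL : ∀ x ∈ (sqLengths L).map (ν * ·), x ≠ 0 := by
    intro x hx
    obtain ⟨y, hy, rfl⟩ := List.mem_map.1 hx
    exact mul_ne_zero hν (hLne y hy)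
  have hb : k ^ 2 * ((f : ℚ) + g + 1) ≠ 0 :=
    mul_ne_zero (pow_ne_zero _ h.k_pos.ne') (by positivity)
  have hlenS : (sqLengths L).length = f := by rw [sqLengths, List.length_map, hlenL]
  have hprod : ((sqLengths L).map (ν * ·)).prod = ν ^ f * (sqLengths L).prod := by
    rw [List.prod_map_mul]; simp [hlenS]
  obtain ⟨hL2, hL3⟩ := hL.invariants_of_length_eq hlen
  obtain ⟨hM2, hM3⟩ := hM.invariants_of_length_eq hMlen
  have hLsq : sqLengths ((1 : P → ℚ) :: L) = ((f : ℚ) + 1) :: sqLengths L := by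
    rw [← hP]; rfl
  rw [hLsq, List.prod_cons] at hL2
  rw [hMsq, List.prod_append, List.prod_cons, List.prod_ofFn, hprod] at hM2
  refine ⟨sqLengths L, hlenS, hLne, hL2, hM2, fun p _ => ⟨?_, ?_⟩⟩
  · have := hL3 p
    rwa [hLsq, listHasse] at this
  · have := hM3 p
    rwa [hMsq, listHasse_append p (by
        intro x hx
        obtain ⟨i, rfl⟩ := List.mem_ofFn.1 hx
        exact hd i) (by
        intro x hx
        rcases List.mem_cons.1 hx with rfl | hx
        exacts [hb, hνL x hx]),
      listHasse, List.prod_cons, hprod, List.prod_ofFn, ← diagHasse_eq_listHasse p d hd,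
      listHasse_map_mul p hν hLne, hlenS] at this

theorem RatEquiv.sqEquiv_det {n : ℕ} {A : Matrix (Fin n) (Fin n) ℚ} {d : Fin n → ℚ}
    (h : RatEquiv A (diagonal d)) : SqEquiv (∏ i, d i) A.det := by
  obtain ⟨X, hX, h⟩ := h
  refine ⟨X.det, hX, ?_⟩
  rw [← det_diagonal, h, det_mul, det_mul, det_transpose]
  ring

/-- Both conclusions about the invariants of a nonsingular principal submatrix. -/
theorem IsQSIncidence.invariants (h : IsQSIncidence N (G.adjMatrix ℚ) a ν lam k l₁ l₂)
    (hσ : (σ : ℚ) ≠ a) (h0 : (k - l₁) + (l₂ - l₁) * σ = 0) {f g : ℕ}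
    (hf : f + 1 = Fintype.card P) (hg : Fintype.card P + g = Fintype.card V) (e : Fin g ↪ V)
    (he : (principalSub G σ e).det ≠ 0) :
    SqEquiv (ν ^ f) (((f : ℚ) + 1) * ((f : ℚ) + (g : ℚ) + 1) * (principalSub G σ e).det) ∧
      ∀ (p : ℕ) [Fact p.Prime],
        hilbertSym p (-1) ν ^ (f.choose 2) * hilbertSym p ν ((f : ℚ) + 1) =
          hilbertSym p ((f : ℚ) + (g : ℚ) + 1) (-(f : ℚ) - 1) *
          hilbertSym p (-(((f : ℚ) + 1) * ((f : ℚ) + (g : ℚ) + 1))) (principalSub G σ e).det *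
          hasseInv p (principalSub G σ e) := by
  have hex := exists_diagonal _ (principalSub_isSymm G σ e) he
  have hv : (f : ℚ) + 1 ≠ 0 := by positivity
  have hb : (f : ℚ) + g + 1 ≠ 0 := by positivity
  have hdet := hex.choose_spec.2.sqEquiv_det
  have hD : ∏ i, hex.choose i ≠ 0 := Finset.prod_ne_zero_iff.2 fun i _ => hex.choose_spec.1 i
  obtain ⟨L, -, hL, h1, h2, h3⟩ :=
    h.exists_decomposition hσ h0 hf hg e hex.choose_spec.1 hex.choose_spec.2
  have hY := List.prod_ne_zero_of_forall hL
  have hk := h.k_pos.ne'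
  refine ⟨(sqEquiv_of_decomposition hD hb hY hk h1 h2).trans ((SqEquiv.refl _).mul hdet),
    fun p _ => ?_⟩
  rw [hasse_identity_of_decomposition hD hb hv h.nu_pos.ne' hY hk h1 h2 (h3 p).1 (h3 p).2,
    hasseInv, dif_pos hex, hilbertSym_congr_right (neg_ne_zero.2 (mul_ne_zero hv hb)) he hdet,
    neg_add']

end Main

theorem card_filter_comp_equiv {β V : Type*} [Fintype β] [Fintype V] (φ : V ≃ β) (p : β → Prop)
    [DecidablePred p] : (Finset.univ.filter fun i => p (φ i)).card =
      (Finset.univ.filter p).card := by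
  rw [← Fintype.card_subtype, ← Fintype.card_subtype]
  exact Fintype.card_congr (φ.subtypeEquiv fun _ => Iff.rfl)

theorem theorem4p2 {V P β : Type*} [Fintype V] [DecidableEq V] [Fintype P] [DecidableEq P]
    [Fintype β] (G : SimpleGraph V) [DecidableRel G.Adj] (hconn : G.Connected)
    (hsrg : IsStronglyRegular G) (ρ σ : ℤ) (f g : ℕ) (hspec : HasSpectralParameters G ρ σ f g)
    (ν : ℕ) (hν : 0 < ν) (B : β → Finset P) (hB : IsQuasiSymmetricDesign B ν G) :
    (∃ e : Fin g ↪ V, (principalSub G σ e).det ≠ 0) ∧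
    ∀ e : Fin g ↪ V, (principalSub G σ e).det ≠ 0 →
      SqEquiv ((ν : ℚ) ^ f)
        (((f : ℚ) + 1) * ((f : ℚ) + (g : ℚ) + 1) * (principalSub G σ e).det) ∧
      ∀ (p : ℕ) [Fact p.Prime],
        hilbertSym p (-1) (ν : ℚ) ^ (f.choose 2) * hilbertSym p (ν : ℚ) ((f : ℚ) + 1) =
          hilbertSym p ((f : ℚ) + (g : ℚ) + 1) (-(f : ℚ) - 1) *
          hilbertSym p (-(((f : ℚ) + 1) * ((f : ℚ) + (g : ℚ) + 1))) (principalSub G σ e).det *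
          hasseInv p (principalSub G σ e) := by
  obtain ⟨v, k, lam, r, l₁, l₂, hD, hr, hrν, hlt, hI, ⟨φ⟩⟩ := hB
  obtain ⟨⟨a, ha, hσρ, hρa, hev, -⟩, hf, hg⟩ := hspec
  have hD' : IsTwoDesign (fun i => B (φ.symm i)) v k lam :=
    ⟨hD.card_points, fun i => hD.card_block _, fun x y hxy => by
      rw [← hD.balance x y hxy]
      exact card_filter_comp_equiv φ.symm.toEquiv fun i => x ∈ B i ∧ y ∈ B i⟩
  have hr' : HasReplication (fun i => B (φ.symm i)) r := fun x => by
    rw [← hr x]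
    exact card_filter_comp_equiv φ.symm.toEquiv fun i => x ∈ B i
  have hI' : intersectionNumbers (fun i => B (φ.symm i)) = {l₁, l₂} := by
    rw [← hI]
    ext m
    constructor
    · rintro ⟨i, j, hij, h⟩
      exact ⟨φ.symm i, φ.symm j, fun h => hij (φ.symm.injective h), h⟩
    · rintro ⟨i, j, hij, h⟩
      exact ⟨φ i, φ j, fun h => hij (φ.injective h), by simpa using h⟩
  have hG (i j : V) : G.Adj i j ↔ i ≠ j ∧ (B (φ.symm i) ∩ B (φ.symm j)).card = l₂ := by
    rw [← φ.symm.map_adj_iff]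
    exact and_congr_left' (not_congr φ.symm.injective.eq_iff)
  have hQ := isQSIncidence_incidenceMatrix ℚ hD' hr' hrν hν hlt hI' hG ha
  have hR := isQSIncidence_incidenceMatrix ℝ hD' hr' hrν hν hlt hI' hG ha
  have hσR : (σ : ℝ) ≠ (a : ℝ) := by exact_mod_cast (hσρ.trans hρa).ne
  have hρR : (ρ : ℝ) ≠ (a : ℝ) := by exact_mod_cast hρa.ne
  have hσQ : (σ : ℚ) ≠ (a : ℚ) := by exact_mod_cast (hσρ.trans hρa).ne
  obtain ⟨x, hx⟩ := ((hev σ).2 (by simp)).exists_hasEigenvector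
  obtain ⟨y, hy⟩ := ((hev ρ).2 (by simp)).exists_hasEigenvector
  obtain ⟨hσ0, hρ0⟩ := hR.eigenvalues_eq (by simpa using hx.apply_eq_smul) hx.2 hσR
    (by simpa using hy.apply_eq_smul) hy.2 hρR (by exact_mod_cast hσρ)
  have hσ0Q : ((k : ℚ) - l₁) + ((l₂ : ℚ) - l₁) * σ = 0 := by exact_mod_cast hσ0
  have hg' := hR.finrank_eigenspace_sigma hσR hσ0
  have hf' := hR.finrank_eigenspace_rho hρR hρ0
  rw [eigMult] at hf hg
  rw [hg] at hg'
  rw [hf] at hf'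
  have hgQ := hQ.finrank_eigenspace_sigma hσQ hσ0Q
  refine ⟨exists_principalSub_det_ne_zero G σ ?_, fun e he => hQ.invariants hσQ hσ0Q hf' hg' e he⟩
  rw [eigSpace]
  omega
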